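/- Let $(x,u,\dot u,\ddot u)$ be the coordinates on the third-order velocities of the Euclidean plane ($u=dx/d\varsigma$, and so on), write $u\cdot v$ for the scalar product, $\|\cdot\|$ for the norm, $\epsilon_{ij}$ for the Levi-Civita symbol ($\epsilon_{12}=1$), $u\wedge v=\epsilon_{ij}u^iv^j$, and lower indices with the Euclidean metric. Let $d_T$ be the total derivative and let $$\delta=\Bigl(i_0-d_Ti_1+\tfrac1{2!}d_T^2i_2-\tfrac1{3!}d_T^3i_3+\cdots\Bigr)d$$ be the Lagrange derivative on differential forms in $x^j,\dot x^j=u^j,\ddot x^j=\dot u^j,\dots$, where $i_0$ multiplies a form by its degree and, for $r\ge1$, $i_r$ is the derivation of degree zero that kills functions and sends $dx_{(s)}^j$ to $\frac{s!}{(s-r)!}\,dx_{(s-r)}^j$ for $s\ge r$ and to $0$ for $s<r$, $x_{(s)}$ being the $s$-th derivative of $x$. Let $E=(E_1,E_2)$ be a smooth function of $(x,u,\dot u,\ddot u)$, defined for $u\neq0$ and effectively depending on $\ddot u$, so that $E=0$ is an autonomous third-order system of ODEs in the plane. Suppose: 1. it is variational: $\delta(E_i\,dx^i)=0$; 2. it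 has Euclidean symmetry: $X(E_l)=0$ on the set $\{E=0\}$ for every prolonged infinitesimal generator $X$ of translations and rotations of the plane; 3. the Frenet curvature $k=\|u\wedge\dot u\|/\|u\|^3$ is a first integral, that is, $d_Tk=0$ at the points of $\{E=0\}$ with $u\wedge\dot u\ne0$; and all curves of constant curvature are included among the solutions, that is, every regular plane curve of constant Frenet curvature has, near each of its points, a regular parametrization that solves $E=0$; 4. every straight line with natural parametrization, $\varsigma\mapsto x+\varsigma u$ with $u\ne0$ (so $\dot u=0$), is a solution. Then, up to a constant non-zero factor, $E$ is of the following form: there are constants $\alpha\neq0$ and $m$ such that for all $(x,u,\dot u,\ddot u)$ with $u\ne0$ $$E_i=\alpha\left(\frac{\epsilon_{ij}\ddot u^j}{\|u\|^3}-3\,\frac{(\dot u\cdot u)}{\|u\|^5}\,\epsilon_{ij}\dot u^j+m\,\frac{\|u\|^2\dot u_i-(\dot u\cdot u)u_i}{\|u\|^3}\right),$$ and $E_i$ is the Euler–Poisson expression of $\alpha L$ with $$L=\frac{\epsilon_{ij}u^i\dot u^j}{\|u\|^3}-m\|u\|,$$ that is, $E_i\,dx^i=\delta(\alpha L)$ where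 $u\ne0$. -/

import Mathlib

open Set
open scoped ContDiff InnerProductSpace

noncomputable section

/-! ### The Euclidean plane and its spaces of velocities -/

/-- The Euclidean plane. -/
abbrev Plane : Type := EuclideanSpace ℝ (Fin 2)

/-- The space `T^q M` of `q`-th order velocities of the plane `M`. A point is the array
`(x, u, u̇, ü, …)`; its entry number `s` stands for the `s`-th derivative of the position. -/
abbrev Jet (q : ℕ) : Type := Fin (q + 1) → Plane

/-- The projection `T^q M → T^p M`, `p ≤ q`, forgetting the higher derivatives. -/
def Jet.proj {p q : ℕ} (h : p ≤ q) : Jet q →L[ℝ] Jet p :=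
  ContinuousLinearMap.pi fun s => ContinuousLinearMap.proj (Fin.castLE (Nat.succ_le_succ h) s)

/-- The shift `T^(q+1) M → T^q M`, `(x, u, u̇, …) ↦ (u, u̇, ü, …)`. -/
def Jet.shift (q : ℕ) : Jet (q + 1) →L[ℝ] Jet q :=
  ContinuousLinearMap.pi fun s => ContinuousLinearMap.proj s.succ

/-- The `q`-jet of a parametrized curve at the parameter value `t`. -/
def jetOf (q : ℕ) (c : ℝ → Plane) (t : ℝ) : Jet q := fun s => iteratedDeriv s c t

/-- The Levi-Civita symbol contracted with two vectors, `ε_ij a^i b^j`, with `ε_12 = 1`. -/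
def cross (a b : Plane) : ℝ := a 0 * b 1 - a 1 * b 0

/-- The (co)vector with components `ε_ij a^j`. -/
def eps (a : Plane) : Plane := !₂[a 1, -a 0]

/-! ### Differential forms on the spaces of velocities and the Lagrange derivative -/

/-- Differential `k`-forms on `T^q M`. -/
abbrev JetForm (q k : ℕ) : Type := Jet q → (Jet q) [⋀^Fin k]→L[ℝ] ℝ

/-- The pullback to `T^q M` of a form on `T^p M`, `p ≤ q`. -/
def JetForm.pullback {p q k : ℕ} (h : p ≤ q) (θ : JetForm p k) : JetForm q k :=
  fun z => (θ (Jet.proj h z)).compContinuousLinearMap (Jet.proj h)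

/-- The total derivative of a function, `d_T f = u^i ∂f/∂x^i + u̇^i ∂f/∂u^i + ⋯`. -/
def totalDeriv {q : ℕ} (f : Jet q → ℝ) (z : Jet (q + 1)) : ℝ :=
  fderiv ℝ f (Jet.proj q.le_succ z) (Jet.shift q z)

/-- The total derivative of a form: the derivation over the projection `T^(q+1) M → T^q M` that
acts on functions by `totalDeriv` and commutes with the exterior derivative. The coefficients are
differentiated in the first summand; the second one replaces, in each slot in turn, the coordinate
differential `dx_s` (`x_s` being the `s`-th derivative of `x`) by `d(d_T x_s) = dx_(s+1)`. -/
def JetForm.dT {q k : ℕ} (θ : JetForm q k) : JetForm (q + 1) k :=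
  fun z =>
    (fderiv ℝ θ (Jet.proj q.le_succ z) (Jet.shift q z)).compContinuousLinearMap
        (Jet.proj q.le_succ) +
      (θ (Jet.proj q.le_succ z)).fderivCompContinuousLinearMap (Jet.proj q.le_succ) (Jet.shift q)

/-- The iterated total derivative `(d_T)^r`. -/
def JetForm.dTIter {q k : ℕ} (θ : JetForm q k) : (r : ℕ) → JetForm (q + r) k
  | 0 => θ
  | r + 1 => JetForm.dT (JetForm.dTIter θ r)

/-- The endomorphism of `T^q M` whose transpose sends the coordinate differential `dx_s`
to `(s! / (s-r)!) dx_(s-r)` if `r ≤ s` and to `0` otherwise. -/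
def Jet.vertical (q r : ℕ) : Jet q →L[ℝ] Jet q :=
  ContinuousLinearMap.pi fun s =>
    (Nat.descFactorial s r : ℝ) •
      ContinuousLinearMap.proj (⟨s - r, lt_of_le_of_lt (Nat.sub_le _ _) s.isLt⟩ : Fin (q + 1))

/-- The derivation `i_r` of degree zero of the algebra of forms on `T^q M`: it kills functions and
sends `dx_s` to `(s! / (s-r)!) dx_(s-r)`, or to `0` if `s < r`. In particular `i_0` multiplies
a form by its degree. Its value on `(v_1, …, v_k)` is the sum over `a` of the
values of the form after `v_a` alone has been replaced by `Jet.vertical q r v_a`. -/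
def JetForm.vertDeriv {q k : ℕ} (r : ℕ) (θ : JetForm q k) : JetForm q k :=
  fun z => (θ z).fderivCompContinuousLinearMap (ContinuousLinearMap.id ℝ (Jet q))
    (Jet.vertical q r)

/-- The Lagrange derivative `δ = (i_0 - d_T i_1 + (1/2!) d_T² i_2 - ⋯ + ((-1)^q/q!) d_T^q i_q) d`,
from `k`-forms on `T^q M` to `(k+1)`-forms on `T^(2q) M`. -/
def JetForm.lagrangeDeriv {q k : ℕ} (θ : JetForm q k) : JetForm (q + q) (k + 1) :=
  fun z => ∑ r : Fin (q + 1), ((-1 : ℝ) ^ (r : ℕ) / (Nat.factorial r : ℝ)) •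
    JetForm.pullback (Nat.add_le_add_left (Nat.lt_succ_iff.mp r.isLt) q)
      (JetForm.dTIter (JetForm.vertDeriv r (fun y => extDeriv θ y)) r) z

/-- A function on `T^q M` as a form of degree zero. -/
def functionForm {q : ℕ} (L : Jet q → ℝ) : JetForm q 0 :=
  fun z => ContinuousAlternatingMap.constOfIsEmpty ℝ (Jet q) (Fin 0) (L z)

/-- The one-form `E_i dx^i` on `T^q M`. -/
def sourceForm {q : ℕ} (E : Jet q → Plane) : JetForm q 1 :=
  fun z => ContinuousAlternatingMap.ofSubsingleton ℝ (Jet q) ℝ (0 : Fin 1)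
    ((innerSL ℝ (E z)).comp (ContinuousLinearMap.proj (0 : Fin (q + 1))))

/-! ### The conditions -/

/-- The equation `E = 0` is of third order: `E` effectively depends on the third derivative. -/
def IsThirdOrder (E : Jet 3 → Plane) : Prop :=
  ∃ (z : Jet 3) (w : Plane), z 1 ≠ 0 ∧ E (Function.update z 3 w) ≠ E z

/-- `δ(E_i dx^i) = 0` over the regular velocities. -/
def IsVariational (E : Jet 3 → Plane) : Prop :=
  ∀ z : Jet (3 + 3), z 1 ≠ 0 → JetForm.lagrangeDeriv (sourceForm E) z = 0

/-- The prolonged generator of the Euclidean motions of the plane: the translation part is `χ`,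
the rotation part is `ϖ` times the prolongation of `x_1 ∂/∂x^2 - x_2 ∂/∂x^1`. -/
def euclideanGenerator (χ : Plane) (ϖ : ℝ) (z : Jet 3) : Jet 3 :=
  fun s => (if s = 0 then χ else 0) - ϖ • eps (z s)

/-- Euclidean symmetry of the system `E = 0`: for every generator `X`, `X(E_l)` vanishes on the
submanifold `E = 0`. -/
def HasEuclideanSymmetry (E : Jet 3 → Plane) : Prop :=
  ∀ (χ : Plane) (ϖ : ℝ) (z : Jet 3), z 1 ≠ 0 → E z = 0 →
    fderiv ℝ E z (euclideanGenerator χ ϖ z) = 0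

/-- The Frenet curvature `‖u ∧ u̇‖ / ‖u‖³`. -/
def frenetCurvature (z : Jet 2) : ℝ := |cross (z 1) (z 2)| / ‖z 1‖ ^ 3

/-- The Frenet curvature is a first integral of `E = 0`: its total derivative vanishes on
`E = 0`, wherever it is differentiable. -/
def CurvatureIsFirstIntegral (E : Jet 3 → Plane) : Prop :=
  ∀ z : Jet 3, cross (z 1) (z 2) ≠ 0 → E z = 0 → totalDeriv frenetCurvature z = 0

/-- The parametrized curve `c` is, on the open set `I` of parameters, a smooth regular solution
of the system `E = 0`. -/
def IsSolutionOn (E : Jet 3 → Plane) (c : ℝ → Plane) (I : Set ℝ) : Prop :=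
  ContDiffOn ℝ ∞ c I ∧ ∀ t ∈ I, deriv c t ≠ 0 ∧ E (jetOf 3 c t) = 0

/-- The system `E = 0` includes all curves of constant curvature: around each of its points, every
such curve can be given a regular parametrization that solves the system. -/
def IncludesConstantCurvatureCurves (E : Jet 3 → Plane) : Prop :=
  ∀ γ : ℝ → Plane, ContDiff ℝ ∞ γ → (∀ s, deriv γ s ≠ 0) →
    (∃ k : ℝ, ∀ s, frenetCurvature (jetOf 2 γ s) = k) →
    ∀ s₀ : ℝ, ∃ (η : ℝ) (φ : ℝ → ℝ), 0 < η ∧ φ 0 = s₀ ∧ ContDiffOn ℝ ∞ φ (Ioo (-η) η) ∧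
      (∀ t ∈ Ioo (-η) η, deriv φ t ≠ 0) ∧ IsSolutionOn E (γ ∘ φ) (Ioo (-η) η)

/-- The system `E = 0` includes the straight lines with natural parametrization, `u̇ = 0`. -/
def IncludesStraightLines (E : Jet 3 → Plane) : Prop :=
  ∀ x u : Plane, u ≠ 0 → IsSolutionOn E (fun t => x + t • u) univ

/-! ### The Lagrange function and the expression -/

/-- `L = ε_ij u^i u̇^j / ‖u‖³ - m ‖u‖`. -/
def curvatureLagrangian (m : ℝ) (z : Jet 2) : ℝ :=
  cross (z 1) (z 2) / ‖z 1‖ ^ 3 - m * ‖z 1‖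

/-- `ε_ij ü^j / ‖u‖³ - 3 (u̇·u) ε_ij u̇^j / ‖u‖⁵ + m (‖u‖² u̇_i - (u̇·u) u_i) / ‖u‖³`. -/
def circleExpression (m : ℝ) (z : Jet 3) : Plane :=
  (1 / ‖z 1‖ ^ 3) • eps (z 3) - (3 * ⟪z 2, z 1⟫_ℝ / ‖z 1‖ ^ 5) • eps (z 2) +
    (m / ‖z 1‖ ^ 3) • (‖z 1‖ ^ 2 • z 2 - ⟪z 2, z 1⟫_ℝ • z 1)

end

/-! The forms on velocity spaces are tested along curves. Paired with jets of a curve and of vector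
fields along it, `d_T` becomes `d/dt`, so the Lagrange derivative becomes an alternating sum of
ordinary derivatives. Polynomial curves realise every finite jet, with the next derivative free, so
coefficients of that derivative may be compared. Testing δ(E_i dx^i) on t^S/S! · e and a constant f
gives the Helmholtz conditions (`helmholtz`).

Write a subscript for a partial derivative. The top condition makes E_ü skew, a multiple of `eps`.
The second-order one, compared in the fourth and then in the third derivative, shows that this
multiple is a function a(x,u). The first-order one makes the rest of E quadratic in u̇, with
second-degree part a_u(u̇) eps u̇; the straight lines remove the part of degree zero. This is
`exists_normal_form`: E = a eps ü + a_u(u̇) eps u̇ + B(x,u)u̇. The remaining conditions give the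
skew part of B, namely −3 a_x(u), and relate a_xu, B_x and B_u.

Where a ≠ 0 the system can be solved for ü, so x, u, u̇ are free on E = 0. Conservation of k then
splits into parts even and odd in u̇ (`first_integral_consequences`): ‖u‖² a_u(v) = −3a (u·v) and
u·Bv = 0. The odd part of rotation symmetry makes B equivariant. Hence its skew part a_x(u) does not
change when u turns; differentiating twice in the direction eps u gives a_x(eps u) = 0, then a_x(u)
= 0, so a_x = 0. Thus a = α/‖u‖³.

Now B is symmetric, annihilates u and is independent of x, so it is its trace times the projection
normal to u. By rotation symmetry the trace is unchanged as u turns; by the first-order Helmholtz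
condition it has degree −1 in u. So it is a constant over ‖u‖, and E has the asserted form. The
Lagrange function is verified directly from its momenta. -/

/-! ### Jets of curves -/

/-- A family of maps in which each member is the derivative of the preceding one. -/
def Holonomic {F : Type*} [NormedAddCommGroup F] [NormedSpace ℝ F] (j : ℝ → ℕ → F) : Prop :=
  ∀ s t, HasDerivAt (fun t => j t s) (j t (s + 1)) t

/-- The initial segment of a sequence of derivatives. -/
def Jet.trunc (q : ℕ) (y : ℕ → Plane) : Jet q := fun s => y s

/-- The holonomic polynomial family with prescribed values at zero. -/
noncomputable def polyJet {F : Type*} [AddCommGroup F] [Module ℝ F] (N : ℕ) (y : ℕ → F) (t : ℝ)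
    (s : ℕ) : F :=
  ∑ k ∈ Finset.range N, (t ^ k / (Nat.factorial k : ℝ)) • y (s + k)

theorem polyJet_zero {F : Type*} [AddCommGroup F] [Module ℝ F] (N : ℕ) (y : ℕ → F) :
    polyJet (N + 1) y 0 = y := by
  funext s
  rw [polyJet, Finset.sum_range_succ']
  simp

/-- The family consists of the successive derivatives of a Taylor polynomial. Differentiation drops
its last term, and the vanishing of y beyond N is what makes the shortened sum equal to the next
member. -/
theorem holonomic_polyJet {F : Type*} [NormedAddCommGroup F] [NormedSpace ℝ F] {N : ℕ} {y : ℕ → F}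
    (hy : ∀ s, N < s → y s = 0) : Holonomic (polyJet (N + 1) y) := by
  intro s t
  have h : HasDerivAt (fun t => polyJet (N + 1) y t s)
      (∑ k ∈ Finset.range (N + 1), ((k : ℝ) * t ^ (k - 1) / (Nat.factorial k : ℝ)) • y (s + k)) t := by
    unfold polyJet
    exact HasDerivAt.fun_sum fun k _ => ((hasDerivAt_pow k t).div_const _).smul_const _
  convert h using 1
  rw [Finset.sum_range_succ', polyJet, Finset.sum_range_succ, hy (s + 1 + N) (by omega)]
  simp only [smul_zero, add_zero, Nat.cast_zero, zero_mul, zero_div, zero_smul]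
  refine Finset.sum_congr rfl fun k _ => ?_
  rw [Nat.factorial_succ, add_tsub_cancel_right, show s + 1 + k = s + (k + 1) by ring]
  congr 1
  push_cast
  have : (k : ℝ) + 1 ≠ 0 := by positivity
  have : (Nat.factorial k : ℝ) ≠ 0 := by positivity
  field_simp

/-! ### Total and Lagrange derivatives along curves -/

@[simp] theorem Jet.proj_trunc {p q : ℕ} (h : p ≤ q) (y : ℕ → Plane) :
    Jet.proj h (Jet.trunc q y) = Jet.trunc p y := rfl

@[simp] theorem Jet.shift_trunc (q : ℕ) (y : ℕ → Plane) :
    Jet.shift q (Jet.trunc (q + 1) y) = Jet.trunc q fun s => y (s + 1) := rfl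

theorem Holonomic.hasDerivAt_trunc {j : ℝ → ℕ → Plane} (hj : Holonomic j) (q : ℕ) (t : ℝ) :
    HasDerivAt (fun t => Jet.trunc q (j t)) (Jet.trunc q fun s => j t (s + 1)) t :=
  hasDerivAt_pi.2 fun s => hj s t

/-- By the product rule, the curve contributes the derivative of the coefficients and each field
contributes the shift of its own slot. These are the two summands of `JetForm.dT`. -/
theorem JetForm.hasDerivAt_dT {q k : ℕ} {θ : JetForm q k} {j : ℝ → ℕ → Plane}
    {v : Fin k → ℝ → ℕ → Plane} (hj : Holonomic j) (hv : ∀ i, Holonomic (v i)) {t : ℝ}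
    (hθ : DifferentiableAt ℝ θ (Jet.trunc q (j t))) :
    HasDerivAt (fun t => θ (Jet.trunc q (j t)) fun i => Jet.trunc q (v i t))
      (JetForm.dT θ (Jet.trunc (q + 1) (j t)) fun i => Jet.trunc (q + 1) (v i t)) t := by
  have h1 := hθ.hasFDerivAt.comp_hasDerivAt t (hj.hasDerivAt_trunc q t)
  have h2 := h1.hasFDerivAt.continuousAlternatingMap_apply
    (fun i => ((hv i).hasDerivAt_trunc q t).hasFDerivAt)
  refine h2.hasDerivAt.congr_deriv ?_
  simp only [JetForm.dT, ContinuousAlternatingMap.add_apply,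
    ContinuousAlternatingMap.compContinuousLinearMap_apply,
    ContinuousAlternatingMap.fderivCompContinuousLinearMap_apply]
  simp only [add_apply, sum_apply,
    ContinuousLinearMap.comp_apply]
  refine congrArg₂ (· + ·) ?_ (Finset.sum_congr rfl fun i _ => ?_)
  · simp
    rfl
  · simp
    congr 1
    funext i'
    by_cases h : i' = i
    · subst h; simp
    · simp [h]

theorem JetForm.contDiffOn_dT {q k : ℕ} (hq : 1 ≤ q) {θ : JetForm q k}
    (hθ : ContDiffOn ℝ ∞ θ {z | z 1 ≠ 0}) : ContDiffOn ℝ ∞ (JetForm.dT θ) {z | z 1 ≠ 0} := by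
  have hopen : IsOpen {z : Jet q | z 1 ≠ 0} := isOpen_ne_fun (continuous_apply 1) continuous_const
  have hmaps : MapsTo (Jet.proj q.le_succ) {z : Jet (q + 1) | z 1 ≠ 0} {z | z 1 ≠ 0} := by
    intro z hz
    have : Fin.castLE (Nat.succ_le_succ q.le_succ) (1 : Fin (q + 1)) = 1 := by
      ext; simp [Nat.mod_eq_of_lt (show 1 < q + 1 by omega)]
    simpa [Jet.proj, this] using hz
  have hd : ContDiffOn ℝ ∞ (fderiv ℝ θ) {z | z 1 ≠ 0} := hθ.fderiv_of_isOpen hopen (by simp)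
  have h1 := (hd.comp (Jet.proj q.le_succ).contDiff.contDiffOn hmaps).clm_apply
    (Jet.shift q).contDiff.contDiffOn
  have h2 := hθ.comp (Jet.proj q.le_succ).contDiff.contDiffOn hmaps
  exact ((ContinuousAlternatingMap.compContinuousLinearMapCLM
      (Jet.proj q.le_succ)).contDiff.comp_contDiffOn h1).add
    (((ContinuousAlternatingMap.fderivCompContinuousLinearMapCLM ℝ
      (Jet.proj q.le_succ)).contDiff.comp_contDiffOn h2).clm_apply contDiffOn_const)

theorem JetForm.contDiffOn_dTIter {q k : ℕ} (hq : 1 ≤ q) {θ : JetForm q k}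
    (hθ : ContDiffOn ℝ ∞ θ {z | z 1 ≠ 0}) (r : ℕ) :
    ContDiffOn ℝ ∞ (JetForm.dTIter θ r) {z : Jet (q + r) | z 1 ≠ 0} := by
  induction r with
  | zero => exact hθ
  | succ r ih => exact JetForm.contDiffOn_dT (q := q + r) (by omega) ih

theorem Jet.trunc_one {q : ℕ} (hq : 1 ≤ q) (y : ℕ → Plane) : Jet.trunc q y 1 = y 1 := by
  simp [Jet.trunc, Nat.mod_eq_of_lt (show 1 < q + 1 by omega)]

theorem JetForm.iteratedDeriv_apply_trunc {q k : ℕ} (hq : 1 ≤ q) {θ : JetForm q k}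
    (hθ : ContDiffOn ℝ ∞ θ {z | z 1 ≠ 0}) {j : ℝ → ℕ → Plane} {v : Fin k → ℝ → ℕ → Plane}
    (hj : Holonomic j) (hv : ∀ i, Holonomic (v i)) (r : ℕ) {t : ℝ} (ht : j t 1 ≠ 0) :
    iteratedDeriv r (fun t => θ (Jet.trunc q (j t)) fun i => Jet.trunc q (v i t)) t =
      JetForm.dTIter θ r (Jet.trunc (q + r) (j t)) fun i => Jet.trunc (q + r) (v i t) := by
  induction r generalizing t with
  | zero => rfl
  | succ r ih =>
    rw [iteratedDeriv_succ]
    have hev : ∀ᶠ t' in nhds t, j t' 1 ≠ 0 :=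
      (hj 1 t).continuousAt.eventually_ne ht
    rw [Filter.EventuallyEq.deriv_eq (hev.mono fun t' ht' => ih ht')]
    have hopen : IsOpen {z : Jet (q + r) | z 1 ≠ 0} :=
      isOpen_ne_fun (continuous_apply 1) continuous_const
    refine (JetForm.hasDerivAt_dT hj hv ?_).deriv
    refine ((JetForm.contDiffOn_dTIter hq hθ r).contDiffAt (hopen.mem_nhds ?_)).differentiableAt
      (by simp)
    simpa [Jet.trunc_one (show 1 ≤ q + r by omega)] using ht

/-- This turns an identity between forms into one between ordinary derivatives in t, where the
fields v can be chosen at will as test variations. -/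
theorem JetForm.lagrangeDeriv_apply_trunc {q k : ℕ} (hq : 1 ≤ q) {θ : JetForm q k}
    (hθ : ContDiffOn ℝ ∞ θ {z | z 1 ≠ 0}) {j : ℝ → ℕ → Plane} {v : Fin (k + 1) → ℝ → ℕ → Plane}
    (hj : Holonomic j) (hv : ∀ i, Holonomic (v i)) {t : ℝ} (ht : j t 1 ≠ 0) :
    JetForm.lagrangeDeriv θ (Jet.trunc (q + q) (j t)) (fun i => Jet.trunc (q + q) (v i t)) =
      ∑ r : Fin (q + 1), ((-1 : ℝ) ^ (r : ℕ) / (Nat.factorial r : ℝ)) *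
        iteratedDeriv r (fun t => JetForm.vertDeriv r (fun y => extDeriv θ y) (Jet.trunc q (j t))
          fun i => Jet.trunc q (v i t)) t := by
  have hopen : IsOpen {z : Jet q | z 1 ≠ 0} := isOpen_ne_fun (continuous_apply 1) continuous_const
  have hext : ContDiffOn ℝ ∞ (fun y => extDeriv θ y) {z | z 1 ≠ 0} :=
    (ContinuousAlternatingMap.alternatizeUncurryFinCLM ℝ (Jet q) ℝ).contDiff.comp_contDiffOn
      (hθ.fderiv_of_isOpen hopen (by simp))
  have hvert : ∀ r, ContDiffOn ℝ ∞ (JetForm.vertDeriv r (fun y => extDeriv θ y)) {z | z 1 ≠ 0} :=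
    fun r => ((ContinuousAlternatingMap.fderivCompContinuousLinearMapCLM ℝ
      (ContinuousLinearMap.id ℝ (Jet q))).contDiff.comp_contDiffOn hext).clm_apply contDiffOn_const
  simp only [JetForm.lagrangeDeriv, ContinuousAlternatingMap.sum_apply,
    ContinuousAlternatingMap.smul_apply, smul_eq_mul]
  refine Finset.sum_congr rfl fun r _ => ?_
  rw [JetForm.iteratedDeriv_apply_trunc hq (hvert r) hj hv r ht]
  rfl

@[simp] theorem Jet.vertical_trunc (q r : ℕ) (y : ℕ → Plane) :
    Jet.vertical q r (Jet.trunc q y) =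
      Jet.trunc q fun s => (Nat.descFactorial s r : ℝ) • y (s - r) := rfl

theorem Holonomic.iteratedDeriv_eq {F : Type*} [NormedAddCommGroup F] [NormedSpace ℝ F]
    {j : ℝ → ℕ → F} (hj : Holonomic j) (r s : ℕ) (t : ℝ) :
    iteratedDeriv r (fun t => j t s) t = j t (s + r) := by
  induction r generalizing t with
  | zero => simp
  | succ r ih =>
    rw [iteratedDeriv_succ, funext ih]
    exact (hj (s + r) t).deriv

theorem Holonomic.contDiff {F : Type*} [NormedAddCommGroup F] [NormedSpace ℝ F]
    {j : ℝ → ℕ → F} (hj : Holonomic j) (s : ℕ) : ContDiff ℝ ∞ (fun t => j t s) := by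
  refine contDiff_of_differentiable_iteratedDeriv fun m _ => ?_
  rw [funext (hj.iteratedDeriv_eq m s)]
  exact fun t => (hj (s + m) t).differentiableAt

theorem Holonomic.contDiff_trunc {j : ℝ → ℕ → Plane} (hj : Holonomic j) (q : ℕ) :
    ContDiff ℝ ∞ (fun t => Jet.trunc q (j t)) :=
  contDiff_pi.2 fun s => hj.contDiff s

theorem Holonomic.smul_const {F : Type*} [NormedAddCommGroup F] [NormedSpace ℝ F]
    {φ : ℝ → ℕ → ℝ} (hφ : Holonomic φ) (e : F) : Holonomic fun t s => φ t s • e :=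
  fun s t => (hφ s t).smul_const e

theorem holonomic_const {F : Type*} [NormedAddCommGroup F] [NormedSpace ℝ F] (f : F) :
    Holonomic fun _ s => if s = 0 then f else 0 := by
  intro s t
  simpa using hasDerivAt_const t (if s = 0 then f else 0)

theorem isOpen_regular (q : ℕ) : IsOpen {z : Jet q | z 1 ≠ 0} :=
  isOpen_ne_fun (continuous_apply 1) continuous_const

theorem Jet.trunc_eq_sum_single (q : ℕ) (y : ℕ → Plane) :
    Jet.trunc q y = ∑ s : Fin (q + 1), (Pi.single s (y s) : Jet q) := by
  funext s
  simp [Jet.trunc, Finset.sum_pi_single]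

/-! ### Helmholtz conditions for a source form -/

theorem contDiffOn_sourceForm {q : ℕ} {E : Jet q → Plane} {U : Set (Jet q)}
    (hE : ContDiffOn ℝ ∞ E U) : ContDiffOn ℝ ∞ (sourceForm E) U := by
  have h : ContDiffOn ℝ ∞ (fun z => (innerSL ℝ (E z)).comp
      (ContinuousLinearMap.proj (R := ℝ) (φ := fun _ : Fin (q + 1) => Plane) 0)) U :=
    ((innerSL ℝ).contDiff.comp_contDiffOn hE).clm_comp contDiffOn_const
  exact (ContinuousAlternatingMap.ofSubsingletonLIE (𝕜 := ℝ) (E := Jet q) (F := ℝ)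
    (0 : Fin 1)).contDiff.comp_contDiffOn h

theorem extDeriv_sourceForm_apply {q : ℕ} {E : Jet q → Plane} {U : Set (Jet q)}
    (hE : ContDiffOn ℝ ∞ E U) (hU : IsOpen U) {z : Jet q} (hz : z ∈ U) (V : Fin 2 → Jet q) :
    extDeriv (sourceForm E) z V =
      ⟪fderiv ℝ E z (V 0), V 1 0⟫_ℝ - ⟪fderiv ℝ E z (V 1), V 0 0⟫_ℝ := by
  have hd : DifferentiableAt ℝ E z := (hE.contDiffAt (hU.mem_nhds hz)).differentiableAt (by simp)
  have hs : DifferentiableAt ℝ (sourceForm E) z :=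
    ((contDiffOn_sourceForm hE).contDiffAt (hU.mem_nhds hz)).differentiableAt (by simp)
  rw [extDeriv_apply hs, Fin.sum_univ_two]
  have key : ∀ X Y : Jet q, fderiv ℝ (fun z => sourceForm E z ![X]) z Y =
      ⟪fderiv ℝ E z Y, X 0⟫_ℝ := by
    intro X Y
    have : (fun z => sourceForm E z ![X]) = fun z => ⟪E z, X 0⟫_ℝ := by
      funext z; simp [sourceForm]
    rw [this, fderiv_inner_apply ℝ hd (by fun_prop)]
    simp
  have h0 : (0 : Fin 2).removeNth V = ![V 1] := by
    funext i; fin_cases i; rfl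
  have h1 : (1 : Fin 2).removeNth V = ![V 0] := by
    funext i; fin_cases i; rfl
  rw [h0, h1, key, key]
  simp [sub_eq_add_neg]

theorem JetForm.vertDeriv_apply_two {q : ℕ} (r : ℕ) (θ : JetForm q 2) (z X Y : Jet q) :
    JetForm.vertDeriv r θ z ![X, Y] =
      θ z ![Jet.vertical q r X, Y] + θ z ![X, Jet.vertical q r Y] := by
  rw [JetForm.vertDeriv, ContinuousAlternatingMap.fderivCompContinuousLinearMap_apply,
    Fin.sum_univ_two]
  congr 2 <;> funext i <;> fin_cases i <;> simp

/-- The exterior derivative of E_i dx^i pairs the derivative of E along one vector with the position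
entry of the other. For r > 0 the vertical endomorphism produces vectors with zero position entry,
so the terms under `r = 0` come from i_0 only. The constant field has only a position entry, which
is moved to entry r with factor r!. -/
theorem vertDeriv_extDeriv_sourceForm {q : ℕ} {E : Jet q → Plane} {U : Set (Jet q)}
    (hE : ContDiffOn ℝ ∞ E U) (hU : IsOpen U) {z : Jet q} (hz : z ∈ U) (r : ℕ) (φ : ℕ → ℝ)
    (e f : Plane) :
    JetForm.vertDeriv r (fun y => extDeriv (sourceForm E) y) z
        ![Jet.trunc q fun s => φ s • e, Jet.trunc q fun s => if s = 0 then f else 0] =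
      ∑ s : Fin (q + 1), (Nat.descFactorial s r : ℝ) *
          (φ (s - r) * ⟪fderiv ℝ E z (Pi.single s e), f⟫_ℝ) +
        (if r = 0 then ∑ s : Fin (q + 1), φ s * ⟪fderiv ℝ E z (Pi.single s e), f⟫_ℝ else 0) -
        (if r = 0 then φ 0 * ⟪fderiv ℝ E z (Pi.single 0 f), e⟫_ℝ else 0) -
        φ 0 * ∑ s : Fin (q + 1), (if (s : ℕ) = r then (Nat.factorial r : ℝ) *
          ⟪fderiv ℝ E z (Pi.single s f), e⟫_ℝ else 0) := by
  have hX : ∀ (r : ℕ) (e : Plane), fderiv ℝ E z (Jet.trunc q fun s =>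
      (Nat.descFactorial s r : ℝ) • φ (s - r) • e) =
      ∑ s : Fin (q + 1), (Nat.descFactorial s r * φ (s - r)) • fderiv ℝ E z (Pi.single s e) := by
    intro r e
    rw [Jet.trunc_eq_sum_single, map_sum]
    refine Finset.sum_congr rfl fun s _ => ?_
    rw [smul_smul, Pi.single_smul, map_smul]
  have hX0 : fderiv ℝ E z (Jet.trunc q fun s => φ s • e) =
      ∑ s : Fin (q + 1), φ s • fderiv ℝ E z (Pi.single s e) := by
    simpa using hX 0 e
  have hY : fderiv ℝ E z (Jet.trunc q fun s =>
      (Nat.descFactorial s r : ℝ) • if s - r = 0 then f else 0) =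
      ∑ s : Fin (q + 1), if (s : ℕ) = r then (Nat.factorial r : ℝ) •
        fderiv ℝ E z (Pi.single s f) else 0 := by
    rw [Jet.trunc_eq_sum_single, map_sum]
    refine Finset.sum_congr rfl fun s _ => ?_
    rw [Pi.single_smul, map_smul]
    rcases lt_trichotomy (s : ℕ) r with h | h | h
    · simp [Nat.descFactorial_eq_zero_iff_lt.2 h, h.ne]
    · simp [h, Nat.descFactorial_self]
    · simp [h.ne', Nat.sub_eq_zero_iff_le, h.not_ge]
  have hY0 : fderiv ℝ E z (Jet.trunc q fun s => if s = 0 then f else 0) =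
      fderiv ℝ E z (Pi.single 0 f) := by
    rw [Jet.trunc_eq_sum_single, map_sum, Fin.sum_univ_succ]
    simp
  refine (JetForm.vertDeriv_apply_two r (fun y => extDeriv (sourceForm E) y) _ _ _).trans ?_
  rw [extDeriv_sourceForm_apply hE hU hz, extDeriv_sourceForm_apply hE hU hz]
  simp only [Matrix.cons_val_zero, Matrix.cons_val_one, Jet.vertical_trunc, hX, hX0, hY, hY0]
  simp only [Jet.trunc, Fin.val_zero, sum_inner, inner_smul_left, inner_smul_right]
  simp only [apply_ite (fun x : Plane => ⟪x, e⟫_ℝ), inner_zero_left, inner_smul_left]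
  by_cases hr : r = 0
  · subst hr
    simp
    ring
  · simp [hr, Nat.descFactorial_eq_zero_iff_lt.2 (Nat.pos_of_ne_zero hr), mul_assoc]
    ring

/-- The coefficient `∂E_i/∂x^j_(s)` contracted with `e^j` and `f^i`, along a curve. -/
noncomputable def coefAlong (E : Jet 3 → Plane) (j : ℝ → ℕ → Plane) (s : Fin 4) (e f : Plane)
    (t : ℝ) : ℝ :=
  ⟪fderiv ℝ E (Jet.trunc 3 (j t)) (Pi.single s e), f⟫_ℝ

theorem contDiffAt_coefAlong {E : Jet 3 → Plane} (hE : ContDiffOn ℝ ∞ E {z | z 1 ≠ 0})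
    {j : ℝ → ℕ → Plane} (hj : Holonomic j) {t : ℝ} (ht : j t 1 ≠ 0) (s : Fin 4) (e f : Plane) :
    ContDiffAt ℝ ∞ (coefAlong E j s e f) t := by
  have h1 : ContDiffAt ℝ ∞ (fderiv ℝ E) (Jet.trunc 3 (j t)) :=
    (hE.fderiv_of_isOpen (isOpen_regular 3) (by simp)).contDiffAt ((isOpen_regular 3).mem_nhds ht)
  have h2 := h1.comp t (hj.contDiff_trunc 3).contDiffAt
  exact (h2.clm_apply contDiffAt_const).inner ℝ contDiffAt_const

/-- Evaluating the vanishing two-form on φe and f, with φ(t) = t^S/S!, isolates one Helmholtz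
condition. The right-hand side comes from the position entry of φe; of the remaining terms only one
copy of the left-hand side survives. -/
theorem helmholtz {E : Jet 3 → Plane} (hE : ContDiffOn ℝ ∞ E {z | z 1 ≠ 0})
    (hvar : IsVariational E) {j : ℝ → ℕ → Plane} (hj : Holonomic j) (h0 : j 0 1 ≠ 0)
    (S : Fin 4) (hS : S ≠ 0) (e f : Plane) :
    coefAlong E j S e f 0 = ∑ s : Fin 4, if S ≤ s then
      (-1 : ℝ) ^ (s : ℕ) * (Nat.choose s S : ℝ) *
        iteratedDeriv ((s : ℕ) - S) (coefAlong E j s f e) 0 else 0 := by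
  -- At time zero the only nonzero derivative of φ is the one of order S, so the Leibniz rule leaves
  -- a single term in each product.
  set φ : ℝ → ℕ → ℝ := polyJet 4 fun k => if k = S then 1 else 0 with hφdef
  have hφ : Holonomic φ := holonomic_polyJet fun s hs => if_neg (by omega)
  have hφ0 : ∀ k, φ 0 k = if k = S then 1 else 0 := fun k => by rw [hφdef, polyJet_zero]
  have hv : ∀ i, Holonomic ((![fun t s => φ t s • e, fun _ s => if s = 0 then f else 0] :
      Fin 2 → ℝ → ℕ → Plane) i) := by
    intro i
    fin_cases i
    · exact hφ.smul_const e
    · exact holonomic_const f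
  have h := JetForm.lagrangeDeriv_apply_trunc (by norm_num) (contDiffOn_sourceForm hE) hj hv h0
  rw [hvar _ h0] at h
  have hev : ∀ r : ℕ, iteratedDeriv r (fun t => JetForm.vertDeriv r
      (fun y => extDeriv (sourceForm E) y) (Jet.trunc 3 (j t)) fun i => Jet.trunc 3
        ((![fun t s => φ t s • e, fun _ s => if s = 0 then f else 0] :
          Fin 2 → ℝ → ℕ → Plane) i t)) 0 =
      iteratedDeriv r (fun t =>
        ∑ s : Fin 4, (Nat.descFactorial s r : ℝ) * (φ t (s - r) * coefAlong E j s e f t) +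
        (if r = 0 then ∑ s : Fin 4, φ t s * coefAlong E j s e f t else 0) -
        (if r = 0 then φ t 0 * coefAlong E j 0 f e t else 0) -
        φ t 0 * ∑ s : Fin 4, (if (s : ℕ) = r then (Nat.factorial r : ℝ) *
          coefAlong E j s f e t else 0)) 0 := by
    intro r
    refine Filter.EventuallyEq.iteratedDeriv_eq r ?_
    filter_upwards [(hj 1 0).continuousAt.eventually_ne h0] with t ht
    refine Eq.trans ?_ (vertDeriv_extDeriv_sourceForm hE (isOpen_regular 3) (z := Jet.trunc 3 (j t))
      ht r (φ t) e f)
    congr 1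
    funext i
    fin_cases i <;> rfl
  have hmul : ∀ (k r : ℕ) (a : ℝ → ℝ), ContDiffAt ℝ ∞ a 0 →
      iteratedDeriv r (fun t => φ t k * a t) 0 =
        ∑ i ∈ Finset.range (r + 1), (Nat.choose r i : ℝ) * (if k + i = S then 1 else 0) *
          iteratedDeriv (r - i) a 0 := by
    intro k r a ha
    rw [iteratedDeriv_fun_mul (((hφ.contDiff k).contDiffAt).of_le (by exact_mod_cast le_top))
      (ha.of_le (by exact_mod_cast le_top))]
    simp only [hφ.iteratedDeriv_eq, hφ0]
  have hc : ∀ (r k : ℕ) (a : ℝ → ℝ), ContDiffAt ℝ ∞ a 0 →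
      ContDiffAt ℝ r (fun t => φ t k * a t) 0 := fun r k a ha =>
    (((hφ.contDiff k).contDiffAt).mul ha).of_le (by exact_mod_cast le_top)
  have ha : ∀ s e f, ContDiffAt ℝ ∞ (coefAlong E j s e f) 0 := contDiffAt_coefAlong hE hj h0
  have hpos : ∀ r : Fin 4, r ≠ 0 → iteratedDeriv (r : ℕ) (fun t =>
        ∑ s : Fin 4, (Nat.descFactorial s r : ℝ) * (φ t (s - r) * coefAlong E j s e f t) +
        (if (r : ℕ) = 0 then ∑ s : Fin 4, φ t s * coefAlong E j s e f t else 0) -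
        (if (r : ℕ) = 0 then φ t 0 * coefAlong E j 0 f e t else 0) -
        φ t 0 * ∑ s : Fin 4, (if (s : ℕ) = r then (Nat.factorial r : ℝ) *
          coefAlong E j s f e t else 0)) 0 =
      ∑ s : Fin 4, (Nat.descFactorial s r : ℝ) *
        iteratedDeriv (r : ℕ) (fun t => φ t (s - r) * coefAlong E j s e f t) 0 -
        (Nat.factorial r : ℝ) * iteratedDeriv (r : ℕ) (fun t => φ t 0 * coefAlong E j r f e t) 0 := by
    intro r hr
    have hr' : (r : ℕ) ≠ 0 := fun h => hr (Fin.ext h)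
    have h1 : ∀ t, φ t 0 * (∑ s : Fin 4, (if (s : ℕ) = r then (Nat.factorial r : ℝ) *
          coefAlong E j s f e t else 0)) =
        (Nat.factorial r : ℝ) * (φ t 0 * coefAlong E j r f e t) := by
      intro t
      simp only [← Fin.ext_iff, Finset.sum_ite_eq', Finset.mem_univ, if_true]
      ring
    simp only [h1, hr', if_false, add_zero, sub_zero]
    have hs : ∀ s ∈ (Finset.univ : Finset (Fin 4)), ContDiffAt ℝ (r : ℕ) (fun t => (Nat.descFactorial s r : ℝ) *
        (φ t (s - r) * coefAlong E j s e f t)) (0 : ℝ) := fun s _ =>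
      contDiffAt_const.mul (hc r _ _ (ha s e f))
    rw [iteratedDeriv_fun_sub (ContDiffAt.sum hs) (contDiffAt_const.mul (hc r _ _ (ha r f e))),
      iteratedDeriv_fun_sum hs, iteratedDeriv_const_mul_field]
    simp only [iteratedDeriv_const_mul_field]
  have e0 := hev 0
  have e1 := (hev 1).trans (hpos 1 (by decide))
  have e2 := (hev 2).trans (hpos 2 (by decide))
  have e3 := (hev 3).trans (hpos 3 (by decide))
  rw [Fin.sum_univ_four] at h
  simp only [Fin.val_zero, Fin.val_one, Fin.val_two, show ((3 : Fin 4) : ℕ) = 3 from rfl] at h e0 e1 e2 e3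
  erw [e0, e1, e2, e3] at h
  simp only [hmul _ _ _ (ha _ _ _)] at h
  clear e0 e1 e2 e3 hev
  -- Since i_0 doubles a two-form, the S-th coefficient appears twice. One copy is absorbed by the
  -- sum over r of (−1)^r C(s,r) C(r,s−S), which vanishes exactly because S ≠ 0.
  fin_cases S
  · exact absurd rfl hS
  all_goals
    simp [Fin.sum_univ_four, Finset.sum_range_succ, Nat.descFactorial, Nat.factorial, hφ0] at h
    simp [Fin.sum_univ_four, Nat.choose]
    linarith

/-! ### The right-angle rotation, and jets realised by curves -/

/-- `eps` as a continuous linear map. -/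
noncomputable def epsL : Plane →L[ℝ] Plane :=
  LinearMap.toContinuousLinearMap
    { toFun := eps
      map_add' := fun a b => by
        ext i; fin_cases i <;> simp [eps]; ring
      map_smul' := fun c a => by
        ext i; fin_cases i <;> simp [eps] }

theorem epsL_apply (a : Plane) : epsL a = eps a := rfl

theorem eps_smul (c : ℝ) (a : Plane) : eps (c • a) = c • eps a := epsL.map_smul c a

@[simp] theorem eps_apply_zero (a : Plane) : eps a 0 = a 1 := rfl
@[simp] theorem eps_apply_one (a : Plane) : eps a 1 = -a 0 := rfl

theorem inner_plane (a b : Plane) : ⟪a, b⟫_ℝ = a 0 * b 0 + a 1 * b 1 := by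
  simp [PiLp.inner_apply, Fin.sum_univ_two, mul_comm]

theorem plane_eq_sum (a : Plane) :
    a = a 0 • !₂[(1 : ℝ), 0] + a 1 • !₂[(0 : ℝ), 1] := by
  ext i; fin_cases i <;> simp

/-- Truncation or extension by zero of a jet. -/
noncomputable def Jet.extend (p q : ℕ) : Jet p →L[ℝ] Jet q :=
  ContinuousLinearMap.pi fun s => if h : (s : ℕ) < p + 1 then ContinuousLinearMap.proj ⟨s, h⟩ else 0

theorem exists_holonomic_of_jet {q : ℕ} (z : Jet q) :
    ∃ j : ℝ → ℕ → Plane, Holonomic j ∧ (∀ s : Fin (q + 1), j 0 s = z s) ∧ ∀ s, q < s → j 0 s = 0 := by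
  refine ⟨polyJet (q + 1) fun s => if h : s < q + 1 then z ⟨s, h⟩ else 0,
    holonomic_polyJet fun s hs => dif_neg (by omega), ?_, ?_⟩
  · intro s
    rw [polyJet_zero]
    simp only [s.isLt, dite_true]
  · intro s hs
    rw [polyJet_zero, dif_neg (by omega)]

theorem eq_of_fderiv_single_eq_zero {q : ℕ} {F : Type*} [NormedAddCommGroup F] [NormedSpace ℝ F]
    {G : Jet q → F} (hG : DifferentiableOn ℝ G {z | z 1 ≠ 0}) {s : Fin (q + 1)} (hs : s ≠ 1)
    (h0 : ∀ z : Jet q, z 1 ≠ 0 → ∀ h : Plane, fderiv ℝ G z (Pi.single s h) = 0)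
    {z : Jet q} (hz : z 1 ≠ 0) (h : Plane) : G (z + Pi.single s h) = G z := by
  have hreg : ∀ t : ℝ, (z + t • (Pi.single s h : Jet q)) 1 ≠ 0 := by
    intro t
    simpa [Pi.single_eq_of_ne hs.symm] using hz
  have hd : ∀ t : ℝ, HasDerivAt (fun t : ℝ => G (z + t • (Pi.single s h : Jet q))) 0 t := by
    intro t
    have h1 : HasDerivAt (fun t : ℝ => z + t • (Pi.single s h : Jet q)) (Pi.single s h) t := by
      simpa using ((hasDerivAt_id t).smul_const (Pi.single s h : Jet q)).const_add z
    have h2 := ((hG.differentiableAt ((isOpen_regular q).mem_nhds (hreg t))).hasFDerivAt).comp_hasDerivAt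
      t h1
    rwa [h0 _ (hreg t)] at h2
  have := is_const_of_deriv_eq_zero (fun t => (hd t).differentiableAt) (fun t => (hd t).deriv) 1 0
  simpa using this

theorem Holonomic.hasDerivAt_comp_trunc {q : ℕ} {F : Type*} [NormedAddCommGroup F] [NormedSpace ℝ F]
    {G : Jet q → F} {j : ℝ → ℕ → Plane} (hj : Holonomic j) {t : ℝ}
    (hG : DifferentiableAt ℝ G (Jet.trunc q (j t))) :
    HasDerivAt (fun t => G (Jet.trunc q (j t)))
      (fderiv ℝ G (Jet.trunc q (j t)) (Jet.trunc q fun s => j t (s + 1))) t :=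
  hG.hasFDerivAt.comp_hasDerivAt t (hj.hasDerivAt_trunc q t)

/-! ### The conditions order by order, and affine dependence on the third derivative -/

section Structure

variable {E : Jet 3 → Plane}

theorem helmholtz_three (hE : ContDiffOn ℝ ∞ E {z | z 1 ≠ 0}) (hvar : IsVariational E)
    {z : Jet 3} (hz : z 1 ≠ 0) (e f : Plane) :
    ⟪fderiv ℝ E z (Pi.single 3 e), f⟫_ℝ = -⟪fderiv ℝ E z (Pi.single 3 f), e⟫_ℝ := by
  obtain ⟨j, hj, hjz, -⟩ := exists_holonomic_of_jet z
  have h0 : j 0 1 ≠ 0 := by have := hjz 1; simp at this; rwa [this]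
  have htr : Jet.trunc 3 (j 0) = z := funext hjz
  have h := helmholtz hE hvar hj h0 3 (by decide) e f
  simp [Fin.sum_univ_four, coefAlong, htr] at h
  simpa [pow_succ] using h

theorem helmholtz_two (hE : ContDiffOn ℝ ∞ E {z | z 1 ≠ 0}) (hvar : IsVariational E)
    {j : ℝ → ℕ → Plane} (hj : Holonomic j) (h0 : j 0 1 ≠ 0) (e f : Plane) :
    coefAlong E j 2 e f 0 = coefAlong E j 2 f e 0 - 3 * deriv (coefAlong E j 3 f e) 0 := by
  have h := helmholtz hE hvar hj h0 2 (by decide) e f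
  simp [Fin.sum_univ_four, Nat.choose] at h
  rw [h]; ring

theorem helmholtz_one (hE : ContDiffOn ℝ ∞ E {z | z 1 ≠ 0}) (hvar : IsVariational E)
    {j : ℝ → ℕ → Plane} (hj : Holonomic j) (h0 : j 0 1 ≠ 0) (e f : Plane) :
    coefAlong E j 1 e f 0 = -coefAlong E j 1 f e 0 + 2 * deriv (coefAlong E j 2 f e) 0 -
      3 * deriv (deriv (coefAlong E j 3 f e)) 0 := by
  have h := helmholtz hE hvar hj h0 1 (by decide) e f
  simp [Fin.sum_univ_four, iteratedDeriv_succ] at h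
  rw [h]; ring

end Structure

theorem Jet.proj_one {p q : ℕ} (hp : 1 ≤ p) (h : p ≤ q) (z : Jet q) : Jet.proj h z 1 = z 1 := by
  have : Fin.castLE (Nat.succ_le_succ h) (1 : Fin (p + 1)) = 1 := by
    ext; simp [Nat.mod_eq_of_lt (show 1 < p + 1 by omega), Nat.mod_eq_of_lt (show 1 < q + 1 by omega)]
  show z (Fin.castLE (Nat.succ_le_succ h) 1) = z 1
  rw [this]

theorem mapsTo_proj_regular {p q : ℕ} (hp : 1 ≤ p) (h : p ≤ q) :
    MapsTo (Jet.proj h) {z : Jet q | z 1 ≠ 0} {z : Jet p | z 1 ≠ 0} := fun z hz => by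
  simpa [Jet.proj_one hp h] using hz

theorem Jet.extend_apply {p q : ℕ} (z : Jet p) (s : Fin (q + 1)) :
    Jet.extend p q z s = if h : (s : ℕ) < p + 1 then z ⟨s, h⟩ else 0 := by
  simp only [Jet.extend, ContinuousLinearMap.pi_apply]
  split_ifs <;> rfl

/-- The derivative of order q + 1 stays free while the q-jet is fixed. An identity along curves
thereby becomes a polynomial identity in w, whose coefficients can be compared. -/
theorem exists_holonomic_through {q : ℕ} (z : Jet q) (w : Plane) :
    ∃ j : ℝ → ℕ → Plane, Holonomic j ∧ Jet.trunc q (j 0) = z ∧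
      (Jet.trunc q fun s => j 0 (s + 1)) =
        Jet.shift q (Jet.extend q (q + 1) z) + Pi.single (Fin.last q) w ∧ j 0 (q + 1) = w := by
  obtain ⟨j, hj, hjz, -⟩ := exists_holonomic_of_jet
    (Jet.extend q (q + 1) z + Pi.single (Fin.last (q + 1)) w)
  refine ⟨j, hj, funext fun s => ?_, funext fun s => ?_, ?_⟩
  · have := hjz s.castSucc
    rw [Pi.add_apply, Pi.single_eq_of_ne s.castSucc_lt_last.ne, add_zero, Jet.extend_apply,
      dif_pos (by simpa using s.isLt)] at this
    exact this
  · have := hjz s.succ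
    rw [Fin.val_succ] at this
    rw [Jet.trunc, this, Pi.add_apply, Pi.add_apply, ← Fin.succ_last]
    congr 1
    by_cases h : s = Fin.last q
    · subst h; simp
    · rw [Pi.single_eq_of_ne h, Pi.single_eq_of_ne (by simpa using h)]
  · have := hjz (Fin.last (q + 1))
    rw [Pi.add_apply, Pi.single_eq_same, Jet.extend_apply, dif_neg (by simp), zero_add] at this
    exact this

theorem fderiv_of_affine {E : Jet 3 → Plane} {p : Jet 2 → ℝ} {f : Jet 2 → Plane}
    (hp : ContDiffOn ℝ ∞ p {z | z 1 ≠ 0}) (hf : ContDiffOn ℝ ∞ f {z | z 1 ≠ 0})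
    (hEq : ∀ z : Jet 3, z 1 ≠ 0 → E z =
      p (Jet.proj (Nat.le_succ 2) z) • eps (z 3) + f (Jet.proj (Nat.le_succ 2) z))
    {z : Jet 3} (hz : z 1 ≠ 0) (X : Jet 3) :
    fderiv ℝ E z X =
      fderiv ℝ p (Jet.proj (Nat.le_succ 2) z) (Jet.proj (Nat.le_succ 2) X) • eps (z 3) +
        p (Jet.proj (Nat.le_succ 2) z) • eps (X 3) +
        fderiv ℝ f (Jet.proj (Nat.le_succ 2) z) (Jet.proj (Nat.le_succ 2) X) := by
  have hz' : Jet.proj (Nat.le_succ 2) z ∈ {z : Jet 2 | z 1 ≠ 0} :=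
    mapsTo_proj_regular (by norm_num) _ hz
  have hpd : DifferentiableAt ℝ p (Jet.proj (Nat.le_succ 2) z) :=
    (hp.contDiffAt ((isOpen_regular 2).mem_nhds hz')).differentiableAt (by simp)
  have hfd : DifferentiableAt ℝ f (Jet.proj (Nat.le_succ 2) z) :=
    (hf.contDiffAt ((isOpen_regular 2).mem_nhds hz')).differentiableAt (by simp)
  have h1 := hpd.hasFDerivAt.comp z (Jet.proj (Nat.le_succ 2)).hasFDerivAt
  have h2 := hfd.hasFDerivAt.comp z (Jet.proj (Nat.le_succ 2)).hasFDerivAt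
  have h3 := (epsL.comp (ContinuousLinearMap.proj (R := ℝ) (φ := fun _ : Fin 4 => Plane)
    3)).hasFDerivAt (x := z)
  have h4 := (h1.smul h3).add h2
  have hev : E =ᶠ[nhds z] fun z => p (Jet.proj (Nat.le_succ 2) z) • eps (z 3) +
      f (Jet.proj (Nat.le_succ 2) z) :=
    Filter.eventuallyEq_of_mem ((isOpen_regular 3).mem_nhds hz) hEq
  have h5 := (h4.congr_of_eventuallyEq hev).fderiv
  rw [h5]
  simp [epsL_apply]
  abel

/-- The third-order condition makes ∂E/∂ü skew, hence P times `eps` in the plane. In the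
second-order condition only d_T P contains a fourth derivative, so P does not depend on ü, and E is
affine in ü. -/
theorem exists_affine {E : Jet 3 → Plane} (hE : ContDiffOn ℝ ∞ E {z | z 1 ≠ 0})
    (hvar : IsVariational E) :
    ∃ (p : Jet 2 → ℝ) (f : Jet 2 → Plane), ContDiffOn ℝ ∞ p {z | z 1 ≠ 0} ∧
      ContDiffOn ℝ ∞ f {z | z 1 ≠ 0} ∧ ∀ z : Jet 3, z 1 ≠ 0 → E z =
      p (Jet.proj (Nat.le_succ 2) z) • eps (z 3) + f (Jet.proj (Nat.le_succ 2) z) := by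
  set e₀ : Plane := !₂[1, 0]
  set e₁ : Plane := !₂[0, 1]
  set P : Jet 3 → ℝ := fun z => ⟪fderiv ℝ E z (Pi.single 3 e₁), e₀⟫_ℝ with hP
  have hPs : ContDiffOn ℝ ∞ P {z | z 1 ≠ 0} :=
    ((hE.fderiv_of_isOpen (isOpen_regular 3) (by simp)).clm_apply contDiffOn_const).inner ℝ
      contDiffOn_const
  have hskew : ∀ z : Jet 3, z 1 ≠ 0 → ∀ w, fderiv ℝ E z (Pi.single 3 w) = P z • eps w := by
    intro z hz w
    have h00 := helmholtz_three hE hvar hz e₀ e₀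
    have h11 := helmholtz_three hE hvar hz e₁ e₁
    have h01 := helmholtz_three hE hvar hz e₀ e₁
    have hw : fderiv ℝ E z (Pi.single 3 w) =
        w 0 • fderiv ℝ E z (Pi.single 3 e₀) + w 1 • fderiv ℝ E z (Pi.single 3 e₁) := by
      conv_lhs => rw [plane_eq_sum w]
      rw [Pi.single_add, Pi.single_smul, Pi.single_smul, map_add, map_smul, map_smul]
    have hPz : P z = (fderiv ℝ E z (Pi.single 3 e₁)) 0 := by simp [hP, inner_plane, e₀]
    rw [hw, hPz]
    simp only [inner_plane] at h00 h11 h01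
    have x00 : (fderiv ℝ E z (Pi.single 3 e₀)) 0 = 0 := by simp [e₀] at h00 ⊢; linarith
    have x11 : (fderiv ℝ E z (Pi.single 3 e₁)) 1 = 0 := by simp [e₁] at h11 ⊢; linarith
    have x01 : (fderiv ℝ E z (Pi.single 3 e₀)) 1 = -(fderiv ℝ E z (Pi.single 3 e₁)) 0 := by
      simpa [e₀, e₁] using h01
    ext i
    fin_cases i
    · simp [x00]; ring
    · simp [x11, x01]; ring
  have hPd : DifferentiableOn ℝ P {z | z 1 ≠ 0} := hPs.differentiableOn (by simp)
  have hP3 : ∀ z : Jet 3, z 1 ≠ 0 → ∀ h, fderiv ℝ P z (Pi.single 3 h) = 0 := by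
    intro z hz h
    -- Here w is the fourth derivative; it occurs only in the last term.
    have key : ∀ w : Plane, ⟪fderiv ℝ E z (Pi.single 2 e₀), e₁⟫_ℝ =
        ⟪fderiv ℝ E z (Pi.single 2 e₁), e₀⟫_ℝ -
          3 * fderiv ℝ P z (Jet.shift 3 (Jet.extend 3 4 z) + Pi.single 3 w) := by
      intro w
      obtain ⟨j, hj, hjz, hjs, -⟩ := exists_holonomic_through z w
      have h0 : j 0 1 ≠ 0 := by rw [← hjz] at hz; exact hz
      have h2 := helmholtz_two hE hvar hj h0 e₀ e₁
      have h3 := (hj.hasDerivAt_comp_trunc (t := 0) (G := P)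
        (hPd.differentiableAt ((isOpen_regular 3).mem_nhds (by rw [hjz]; exact hz)))).deriv
      rw [show coefAlong E j 3 e₁ e₀ = fun t => P (Jet.trunc 3 (j t)) from rfl, h3] at h2
      simp only [coefAlong, hjz, hjs] at h2
      exact h2
    have k1 := key h
    have k0 := key 0
    rw [map_add] at k1 k0
    simp only [Pi.single_zero, map_zero] at k0
    linarith
  have hG3 : ∀ z : Jet 3, z 1 ≠ 0 → ∀ h,
      fderiv ℝ (fun z => E z - P z • eps (z 3)) z (Pi.single 3 h) = 0 := by
    intro z hz h
    have h1 := (hE.differentiableOn (by simp)).differentiableAt ((isOpen_regular 3).mem_nhds hz)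
    have h2 := hPd.differentiableAt ((isOpen_regular 3).mem_nhds hz)
    have h3 := (epsL.comp (ContinuousLinearMap.proj (R := ℝ) (φ := fun _ : Fin 4 => Plane)
      3)).hasFDerivAt (x := z)
    have h4 := (h1.hasFDerivAt.sub (h2.hasFDerivAt.smul h3)).fderiv
    refine (DFunLike.congr_fun h4 _).trans ?_
    simp [hskew z hz, hP3 z hz, epsL_apply]
  have hrestr : ∀ z : Jet 3, z = Jet.extend 2 3 (Jet.proj (Nat.le_succ 2) z) + Pi.single 3 (z 3) := by
    intro z
    ext s i
    fin_cases s <;> simp [Jet.extend, Jet.proj]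
  have hmaps : MapsTo (Jet.extend 2 3) {z : Jet 2 | z 1 ≠ 0} {z | z 1 ≠ 0} := fun z hz => hz
  refine ⟨fun y => P (Jet.extend 2 3 y), fun y => E (Jet.extend 2 3 y),
    hPs.comp (Jet.extend 2 3).contDiff.contDiffOn hmaps,
    hE.comp (Jet.extend 2 3).contDiff.contDiffOn hmaps, fun z hz => ?_⟩
  have hz' : Jet.extend 2 3 (Jet.proj (Nat.le_succ 2) z) 1 ≠ 0 :=
    hmaps (mapsTo_proj_regular (by norm_num) _ hz)
  have hPz := eq_of_fderiv_single_eq_zero hPd (by decide) hP3 hz' (z 3)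
  have hGz := eq_of_fderiv_single_eq_zero (G := fun z => E z - P z • eps (z 3))
    ((hE.differentiableOn (by simp)).sub (hPd.smul (epsL.comp (ContinuousLinearMap.proj (R := ℝ)
      (φ := fun _ : Fin 4 => Plane) 3)).differentiable.differentiableOn)) (by decide) hG3 hz' (z 3)
  rw [← hrestr z] at hPz hGz
  show E z = P (Jet.extend 2 3 (Jet.proj (Nat.le_succ 2) z)) • eps (z 3) +
    E (Jet.extend 2 3 (Jet.proj (Nat.le_succ 2) z))
  rw [← hPz]
  have hz3 : Jet.extend 2 3 (Jet.proj (Nat.le_succ 2) z) 3 = 0 := rfl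
  rw [hz3, show eps 0 = 0 from map_zero epsL, smul_zero, sub_zero] at hGz
  rw [← hGz]
  abel

theorem Jet.proj_single {p q : ℕ} (h : p ≤ q) (s : Fin (p + 1)) (e : Plane) :
    Jet.proj h (Pi.single (Fin.castLE (Nat.succ_le_succ h) s) e) = Pi.single s e := by
  funext t
  show (Pi.single (Fin.castLE (Nat.succ_le_succ h) s) e : Jet q) (Fin.castLE _ t) = _
  by_cases hst : t = s
  · subst hst; simp
  · rw [Pi.single_eq_of_ne hst, Pi.single_eq_of_ne (by simpa [Fin.ext_iff] using hst)]

theorem inner_eps_self (v : Plane) : ⟪eps v, v⟫_ℝ = 0 := by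
  rw [inner_plane]; simp; ring

theorem eq_zero_of_inner_eq_zero {a : Plane} (h : ∀ e : Plane, ⟪a, e⟫_ℝ = 0) : a = 0 :=
  inner_self_eq_zero.1 (h a)

section
variable {E : Jet 3 → Plane} {p : Jet 2 → ℝ} {g : Jet 2 → Plane}

theorem coefAlong_affine_three (hp : ContDiffOn ℝ ∞ p {z | z 1 ≠ 0})
    (hg : ContDiffOn ℝ ∞ g {z | z 1 ≠ 0})
    (hEq : ∀ z : Jet 3, z 1 ≠ 0 → E z =
      p (Jet.proj (Nat.le_succ 2) z) • eps (z 3) + g (Jet.proj (Nat.le_succ 2) z))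
    {j : ℝ → ℕ → Plane} {t : ℝ} (ht : j t 1 ≠ 0) (e f : Plane) :
    coefAlong E j 3 e f t = p (Jet.trunc 2 (j t)) * ⟪eps e, f⟫_ℝ := by
  rw [coefAlong, fderiv_of_affine hp hg hEq (by exact ht)]
  have : Jet.proj (Nat.le_succ 2) (Pi.single 3 e : Jet 3) = 0 := by
    funext s; fin_cases s <;> rfl
  rw [this]
  simp [inner_smul_left]

theorem coefAlong_affine_lower (hp : ContDiffOn ℝ ∞ p {z | z 1 ≠ 0})
    (hg : ContDiffOn ℝ ∞ g {z | z 1 ≠ 0})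
    (hEq : ∀ z : Jet 3, z 1 ≠ 0 → E z =
      p (Jet.proj (Nat.le_succ 2) z) • eps (z 3) + g (Jet.proj (Nat.le_succ 2) z))
    {j : ℝ → ℕ → Plane} {t : ℝ} (ht : j t 1 ≠ 0) (s : Fin 3) (e f : Plane) :
    coefAlong E j s.castSucc e f t =
      fderiv ℝ p (Jet.trunc 2 (j t)) (Pi.single s e) * ⟪eps (j t 3), f⟫_ℝ +
        ⟪fderiv ℝ g (Jet.trunc 2 (j t)) (Pi.single s e), f⟫_ℝ := by
  rw [coefAlong, fderiv_of_affine hp hg hEq (by exact ht)]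
  have h1 : Jet.proj (Nat.le_succ 2) (Pi.single s.castSucc e : Jet 3) = Pi.single s e :=
    Jet.proj_single (Nat.le_succ 2) s e
  have h2 : (Pi.single s.castSucc e : Jet 3) 3 = 0 :=
    Pi.single_eq_of_ne (M := fun _ : Fin 4 => Plane) s.castSucc_lt_last.ne' e
  rw [h1, h2, show eps 0 = 0 from map_zero epsL]
  simp [inner_add_left, inner_smul_left, Jet.trunc]

/-- In the second-order condition the coefficients of the third derivative h read −p' = −3p', where
p' is the derivative of p in the u̇-direction h. Hence p' = 0. -/
theorem fderiv_leading_single_two (hE : ContDiffOn ℝ ∞ E {z | z 1 ≠ 0}) (hvar : IsVariational E)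
    (hp : ContDiffOn ℝ ∞ p {z | z 1 ≠ 0}) (hg : ContDiffOn ℝ ∞ g {z | z 1 ≠ 0})
    (hEq : ∀ z : Jet 3, z 1 ≠ 0 → E z =
      p (Jet.proj (Nat.le_succ 2) z) • eps (z 3) + g (Jet.proj (Nat.le_succ 2) z))
    {y : Jet 2} (hy : y 1 ≠ 0) (h : Plane) : fderiv ℝ p y (Pi.single 2 h) = 0 := by
  set e₀ : Plane := !₂[1, 0]
  set e₁ : Plane := !₂[0, 1]
  have key : ∀ w : Plane,
      fderiv ℝ p y (Pi.single 2 e₀) * ⟪eps w, e₁⟫_ℝ + ⟪fderiv ℝ g y (Pi.single 2 e₀), e₁⟫_ℝ =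
      fderiv ℝ p y (Pi.single 2 e₁) * ⟪eps w, e₀⟫_ℝ + ⟪fderiv ℝ g y (Pi.single 2 e₁), e₀⟫_ℝ -
        3 * (fderiv ℝ p y (Jet.shift 2 (Jet.extend 2 3 y)) + fderiv ℝ p y (Pi.single 2 w)) := by
    intro w
    obtain ⟨j, hj, hjz, hjs, hjw⟩ := exists_holonomic_through y w
    have h0 : j 0 1 ≠ 0 := by rw [← hjz] at hy; exact hy
    have h2 := helmholtz_two hE hvar hj h0 e₀ e₁
    have hd : deriv (coefAlong E j 3 e₁ e₀) 0 =
        fderiv ℝ p y (Jet.shift 2 (Jet.extend 2 3 y)) + fderiv ℝ p y (Pi.single 2 w) := by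
      have hev : coefAlong E j 3 e₁ e₀ =ᶠ[nhds 0] fun t => p (Jet.trunc 2 (j t)) := by
        filter_upwards [(hj 1 0).continuousAt.eventually_ne h0] with t ht
        rw [coefAlong_affine_three hp hg hEq ht]
        simp [inner_plane, e₀, e₁]
      rw [hev.deriv_eq]
      have h3 := (hj.hasDerivAt_comp_trunc (t := 0) (G := p) ((hp.differentiableOn (by simp)).differentiableAt
        ((isOpen_regular 2).mem_nhds h0))).deriv
      rw [h3, hjs, hjz, map_add]
      rfl
    rw [hd] at h2
    erw [coefAlong_affine_lower hp hg hEq h0 2, coefAlong_affine_lower hp hg hEq h0 2, hjz, hjw] at h2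
    exact h2
  have k1 := key h
  have k0 := key 0
  have hs : fderiv ℝ p y (Pi.single 2 h) =
      h 0 * fderiv ℝ p y (Pi.single 2 e₀) + h 1 * fderiv ℝ p y (Pi.single 2 e₁) := by
    conv_lhs => rw [plane_eq_sum h]
    rw [Pi.single_add, Pi.single_smul, Pi.single_smul, map_add, map_smul, map_smul]
    rfl
  simp [inner_plane, e₀, e₁] at k1 k0 hs
  simp only [e₀, e₁] at *
  linarith

theorem exists_leading_coefficient (hE : ContDiffOn ℝ ∞ E {z | z 1 ≠ 0}) (hvar : IsVariational E) :
    ∃ (a : Jet 1 → ℝ) (g : Jet 2 → Plane), ContDiffOn ℝ ∞ a {z | z 1 ≠ 0} ∧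
      ContDiffOn ℝ ∞ g {z | z 1 ≠ 0} ∧ ∀ z : Jet 3, z 1 ≠ 0 → E z =
      a (Jet.proj (Nat.le_succ 1) (Jet.proj (Nat.le_succ 2) z)) • eps (z 3) +
        g (Jet.proj (Nat.le_succ 2) z) := by
  obtain ⟨p, g, hp, hg, hEq⟩ := exists_affine hE hvar
  refine ⟨fun y => p (Jet.extend 1 2 y), g,
    hp.comp (Jet.extend 1 2).contDiff.contDiffOn fun z hz => hz, hg, fun z hz => ?_⟩
  set y := Jet.proj (Nat.le_succ 2) z
  have hy : y 1 ≠ 0 := hz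
  have h1 := eq_of_fderiv_single_eq_zero (hp.differentiableOn (by simp)) (s := 2) (by decide)
    (fun y hy h => fderiv_leading_single_two hE hvar hp hg hEq hy h)
    (z := Jet.extend 1 2 (Jet.proj (Nat.le_succ 1) y)) hy (y 2)
  have h2 : Jet.extend 1 2 (Jet.proj (Nat.le_succ 1) y) + Pi.single 2 (y 2) = y := by
    ext s i
    fin_cases s <;> simp [Jet.extend, Jet.proj]
  rw [h2] at h1
  rw [hEq z hz]
  exact congrArg (fun c => c • eps (z 3) + g y) h1

end

/-! ### Quadratic dependence on the second derivative -/

theorem contDiffOn_comp_proj {F : Type*} [NormedAddCommGroup F] [NormedSpace ℝ F] {a : Jet 1 → F}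
    (ha : ContDiffOn ℝ ∞ a {z | z 1 ≠ 0}) :
    ContDiffOn ℝ ∞ (fun y : Jet 2 => a (Jet.proj (Nat.le_succ 1) y)) {z | z 1 ≠ 0} :=
  ha.comp (Jet.proj (Nat.le_succ 1)).contDiff.contDiffOn fun _ hz => hz

theorem fderiv_comp_proj {F : Type*} [NormedAddCommGroup F] [NormedSpace ℝ F] {a : Jet 1 → F}
    (ha : ContDiffOn ℝ ∞ a {z | z 1 ≠ 0}) {y : Jet 2} (hy : y 1 ≠ 0) (X : Jet 2) :
    fderiv ℝ (fun y : Jet 2 => a (Jet.proj (Nat.le_succ 1) y)) y X =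
      fderiv ℝ a (Jet.proj (Nat.le_succ 1) y) (Jet.proj (Nat.le_succ 1) X) := by
  have h1 : DifferentiableAt ℝ a (Jet.proj (Nat.le_succ 1) y) :=
    (ha.differentiableOn (by simp)).differentiableAt ((isOpen_regular 1).mem_nhds hy)
  have h2 := (h1.hasFDerivAt.comp y (Jet.proj (Nat.le_succ 1)).hasFDerivAt).fderiv
  exact DFunLike.congr_fun h2 X

/-- The first-order part of the third-order system: what remains at vanishing third derivative. -/
theorem snd_fderiv_lower {E : Jet 3 → Plane} {a : Jet 1 → ℝ} {g : Jet 2 → Plane}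
    (hE : ContDiffOn ℝ ∞ E {z | z 1 ≠ 0}) (hvar : IsVariational E)
    (ha : ContDiffOn ℝ ∞ a {z | z 1 ≠ 0}) (hg : ContDiffOn ℝ ∞ g {z | z 1 ≠ 0})
    (hEq : ∀ z : Jet 3, z 1 ≠ 0 → E z =
      a (Jet.proj (Nat.le_succ 1) (Jet.proj (Nat.le_succ 2) z)) • eps (z 3) +
        g (Jet.proj (Nat.le_succ 2) z))
    {y : Jet 2} (hy : y 1 ≠ 0) (h : Plane) :
    fderiv ℝ (fderiv ℝ g) y (Pi.single 2 h) (Pi.single 2 h) =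
      (2 * fderiv ℝ a (Jet.proj (Nat.le_succ 1) y) (Pi.single 1 h)) • eps h := by
  set q := Jet.proj (Nat.le_succ 1) y with hq
  have hq1 : q 1 ≠ 0 := hy
  have hap := contDiffOn_comp_proj ha
  have had : ∀ {q : Jet 1}, q 1 ≠ 0 → DifferentiableAt ℝ a q := fun {q} h =>
    (ha.differentiableOn (by simp)).differentiableAt ((isOpen_regular 1).mem_nhds h)
  have hDa : DifferentiableAt ℝ (fderiv ℝ a) q :=
    ((ha.fderiv_of_isOpen (isOpen_regular 1) (m := ∞) (by simp)).differentiableOn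
      (by simp)).differentiableAt ((isOpen_regular 1).mem_nhds hq1)
  have hDg : DifferentiableAt ℝ (fderiv ℝ g) y :=
    ((hg.fderiv_of_isOpen (isOpen_regular 2) (m := ∞) (by simp)).differentiableOn
      (by simp)).differentiableAt ((isOpen_regular 2).mem_nhds hy)
  have ha2 : fderiv ℝ (fun y : Jet 2 => a (Jet.proj (Nat.le_succ 1) y)) y (Pi.single 2 h) = 0 := by
    rw [fderiv_comp_proj ha hy, show Jet.proj (Nat.le_succ 1) (Pi.single 2 h : Jet 2) = 0 from ?_,
      map_zero]
    funext s; fin_cases s <;> rfl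
  have ha1 : ∀ e, fderiv ℝ (fun y : Jet 2 => a (Jet.proj (Nat.le_succ 1) y)) y (Pi.single 1 e) =
      fderiv ℝ a q (Pi.single 1 e) := by
    intro e
    rw [fderiv_comp_proj ha hy]
    exact congrArg _ (Jet.proj_single (Nat.le_succ 1) 1 e)
  set sh : Jet 1 := Jet.proj (Nat.le_succ 1) (Jet.shift 2 (Jet.extend 2 3 y)) with hsh
  -- The first-order Helmholtz condition, with the free third derivative w displayed; the last
  -- bracket is d_T² a.
  have key : ∀ e w : Plane,
      fderiv ℝ a q (Pi.single 1 e) * ⟪eps w, h⟫_ℝ + ⟪fderiv ℝ g y (Pi.single 1 e), h⟫_ℝ =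
      -(fderiv ℝ a q (Pi.single 1 h) * ⟪eps w, e⟫_ℝ + ⟪fderiv ℝ g y (Pi.single 1 h), e⟫_ℝ) +
        2 * ⟪fderiv ℝ (fderiv ℝ g) y (Jet.shift 2 (Jet.extend 2 3 y)) (Pi.single 2 h) +
          fderiv ℝ (fderiv ℝ g) y (Pi.single 2 w) (Pi.single 2 h), e⟫_ℝ -
        3 * ((fderiv ℝ (fderiv ℝ a) q sh sh + fderiv ℝ a q (Pi.single 0 (y 2)) +
          fderiv ℝ a q (Pi.single 1 w)) * ⟪eps h, e⟫_ℝ) := by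
    intro e w
    obtain ⟨j, hj, hjz, hjs, hjw⟩ := exists_holonomic_through y w
    have h0 : j 0 1 ≠ 0 := by rw [← hjz] at hy; exact hy
    have hjq : Jet.trunc 1 (j 0) = q := by rw [hq, ← hjz]; rfl
    have hjs1 : (Jet.trunc 1 fun s => j 0 (s + 1)) = sh := by
      have := congrArg (Jet.proj (Nat.le_succ 1)) hjs
      rw [map_add] at this
      refine this.trans ?_
      rw [show Jet.proj (Nat.le_succ 1) (Pi.single (Fin.last 2) w : Jet 2) = 0 from ?_, add_zero]
      funext s; fin_cases s <;> rfl
    have hne := (hj 1 0).continuousAt.eventually_ne h0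
    have h1 := helmholtz_one hE hvar hj h0 e h
    have c1 := fun e f => coefAlong_affine_lower hap hg hEq h0 1 e f
    simp only [ha1, hjz, hjw] at c1
    have d2 : deriv (coefAlong E j 2 h e) 0 =
        ⟪fderiv ℝ (fderiv ℝ g) y (Jet.shift 2 (Jet.extend 2 3 y)) (Pi.single 2 h) +
          fderiv ℝ (fderiv ℝ g) y (Pi.single 2 w) (Pi.single 2 h), e⟫_ℝ := by
      have hev : coefAlong E j 2 h e =ᶠ[nhds 0] fun t =>
          ⟪fderiv ℝ g (Jet.trunc 2 (j t)) (Pi.single 2 h), e⟫_ℝ := by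
        filter_upwards [hne] with t ht
        refine (coefAlong_affine_lower hap hg hEq ht 2 h e).trans ?_
        rw [fderiv_comp_proj ha (y := Jet.trunc 2 (j t)) ht,
          show Jet.proj (Nat.le_succ 1) (Pi.single 2 h : Jet 2) = 0 from ?_, map_zero, zero_mul,
          zero_add]
        funext s; fin_cases s <;> rfl
      rw [hev.deriv_eq]
      have h3 := hj.hasDerivAt_comp_trunc (t := 0) (G := fderiv ℝ g) (by rw [hjz]; exact hDg)
      rw [hjs, hjz, map_add] at h3
      have h4 := (h3.clm_apply (hasDerivAt_const (0 : ℝ) (Pi.single 2 h : Jet 2))).inner ℝ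
        (hasDerivAt_const (0 : ℝ) e)
      rw [h4.deriv]
      simp
    have d3 : deriv (deriv (coefAlong E j 3 h e)) 0 =
        (fderiv ℝ (fderiv ℝ a) q sh sh + fderiv ℝ a q (Pi.single 0 (y 2)) +
          fderiv ℝ a q (Pi.single 1 w)) * ⟪eps h, e⟫_ℝ := by
      have hev : deriv (coefAlong E j 3 h e) =ᶠ[nhds 0] fun t =>
          fderiv ℝ a (Jet.trunc 1 (j t)) (Jet.trunc 1 fun s => j t (s + 1)) * ⟪eps h, e⟫_ℝ := by
        filter_upwards [hne.eventually_nhds] with t ht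
        have hev' : coefAlong E j 3 h e =ᶠ[nhds t] fun t =>
            a (Jet.trunc 1 (j t)) * ⟪eps h, e⟫_ℝ := by
          filter_upwards [ht] with t ht
          exact coefAlong_affine_three hap hg hEq ht h e
        rw [hev'.deriv_eq]
        exact ((hj.hasDerivAt_comp_trunc (G := a) (had ht.self_of_nhds)).mul_const _).deriv
      rw [hev.deriv_eq]
      have h3 := hj.hasDerivAt_comp_trunc (t := 0) (G := fderiv ℝ a) (by rw [hjq]; exact hDa)
      have hj' : Holonomic fun t s => j t (s + 1) := fun s t => hj (s + 1) t
      have h4 := ((h3.clm_apply (hj'.hasDerivAt_trunc 1 0)).mul_const ⟪eps h, e⟫_ℝ).deriv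
      rw [h4, hjs1, hjq]
      have h5 : (Jet.trunc 1 fun s => j 0 (s + 1 + 1)) = Pi.single 0 (y 2) + Pi.single 1 w := by
        have hy2 : j 0 2 = y 2 := congrFun hjz 2
        funext s
        fin_cases s
        · simpa [Jet.trunc] using hy2
        · simpa [Jet.trunc] using hjw
      rw [h5, map_add, add_assoc]
    rw [d2, d3] at h1
    rw [← c1 e h, ← c1 h e]
    exact h1
  rw [← sub_eq_zero]
  refine eq_zero_of_inner_eq_zero fun e => ?_
  -- Comparing w = h with w = 0 and using that eps h is normal to h leaves 2 g_u̇u̇(h,h)·e = 4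
  -- a_u(h) (eps h·e).
  have k1 := key e h
  have k0 := key e 0
  rw [inner_eps_self] at k1
  simp only [Pi.single_zero, map_zero, zero_apply, inner_add_left,
    show eps 0 = 0 from map_zero epsL, inner_zero_left] at k1 k0
  simp only [inner_sub_left, inner_smul_left]
  simp only [conj_trivial]
  linarith

theorem jetOf_line (x u : Plane) :
    jetOf 3 (fun t : ℝ => x + t • u) 0 = (Pi.single 0 x + Pi.single 1 u : Jet 3) := by
  have h1 : deriv (fun t : ℝ => x + t • u) = fun _ => u := by
    funext t
    simpa using (((hasDerivAt_id t).smul_const u).const_add x).deriv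
  funext s
  fin_cases s
  · simp [jetOf]
  · have h2 : deriv (fun t : ℝ => t • u) 0 = u := by
      simpa using ((hasDerivAt_id (0 : ℝ)).smul_const u).deriv
    simp [jetOf, h2]
  · simp [jetOf, iteratedDeriv_succ, h1]
  · simp [jetOf, iteratedDeriv_succ, h1]

/-- A function with constant second derivative is a quadratic polynomial. -/
theorem eq_quadratic_of_hasDerivAt {F : Type*} [NormedAddCommGroup F] [NormedSpace ℝ F]
    {γ γ' : ℝ → F} {C : F} (h1 : ∀ t, HasDerivAt γ (γ' t) t) (h2 : ∀ t, HasDerivAt γ' ((2 : ℝ) • C) t) :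
    γ 1 = γ 0 + γ' 0 + C := by
  have hC : ∀ t : ℝ, HasDerivAt (fun t : ℝ => t • ((2 : ℝ) • C)) ((2 : ℝ) • C) t := fun t => by
    simpa using (hasDerivAt_id t).smul_const ((2 : ℝ) • C)
  have e1 : ∀ t, γ' t = γ' 0 + t • ((2 : ℝ) • C) := by
    intro t
    have := is_const_of_deriv_eq_zero (f := fun t => γ' t - t • ((2 : ℝ) • C))
      (fun t => ((h2 t).sub (hC t)).differentiableAt)
      (fun t => ((h2 t).sub (hC t)).deriv.trans (sub_self _)) t 0
    simp only [zero_smul, sub_zero] at this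
    rw [← this]; abel
  have hq : ∀ t : ℝ, HasDerivAt (fun t : ℝ => t • γ' 0 + t ^ 2 • C) (γ' t) t := by
    intro t
    have h3 := ((hasDerivAt_id t).smul_const (γ' 0)).add ((hasDerivAt_pow 2 t).smul_const C)
    refine h3.congr_deriv ?_
    rw [e1 t, smul_smul]
    simp [mul_comm]
  have := is_const_of_deriv_eq_zero (f := fun t => γ t - (t • γ' 0 + t ^ 2 • C))
    (fun t => ((h1 t).sub (hq t)).differentiableAt)
    (fun t => ((h1 t).sub (hq t)).deriv.trans (sub_self _)) 1 0
  simp only [one_smul, one_pow, zero_smul, ne_eq, OfNat.ofNat_ne_zero, not_false_eq_true, zero_pow,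
    add_zero, sub_zero] at this
  rw [← this]; abel

/-- The position and the velocity of a third-order jet. -/
def Jet.velocity : Jet 3 →L[ℝ] Jet 1 := Jet.proj (by norm_num)

/-- Along t ↦ (x, u, t u̇) the second derivative of the lower-order part g is the constant 2 a_u(u̇)
eps u̇, so g is a quadratic polynomial there. B is its derivative at zero acceleration. -/
theorem exists_normal_form {E : Jet 3 → Plane} (hE : ContDiffOn ℝ ∞ E {z | z 1 ≠ 0})
    (hvar : IsVariational E) (hline : IncludesStraightLines E) :
    ∃ (a : Jet 1 → ℝ) (B : Jet 1 → Plane →L[ℝ] Plane), ContDiffOn ℝ ∞ a {z | z 1 ≠ 0} ∧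
      ContDiffOn ℝ ∞ B {z | z 1 ≠ 0} ∧ ∀ z : Jet 3, z 1 ≠ 0 → E z =
        a (Jet.velocity z) • eps (z 3) +
          fderiv ℝ a (Jet.velocity z) (Pi.single 1 (z 2)) • eps (z 2) + B (Jet.velocity z) (z 2) := by
  obtain ⟨a, g, ha, hg, hEq⟩ := exists_leading_coefficient hE hvar
  have hDgs : ContDiffOn ℝ ∞ (fderiv ℝ g) {z | z 1 ≠ 0} :=
    hg.fderiv_of_isOpen (isOpen_regular 2) (by simp)
  refine ⟨a, fun q => (fderiv ℝ g (Jet.extend 1 2 q)).comp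
    (ContinuousLinearMap.single ℝ (fun _ : Fin 3 => Plane) 2), ha,
    (hDgs.comp (Jet.extend 1 2).contDiff.contDiffOn fun z hz => hz).clm_comp contDiffOn_const, ?_⟩
  intro z hz
  rw [hEq z hz, add_assoc]
  refine congrArg₂ (· + ·) rfl ?_
  set y := Jet.proj (Nat.le_succ 2) z with hy
  set y₀ : Jet 2 := Jet.extend 1 2 (Jet.velocity z) with hy₀
  set s : Jet 2 := Pi.single 2 (z 2) with hs
  have hreg : ∀ t : ℝ, (y₀ + t • s) 1 ≠ 0 := by
    intro t
    have : (y₀ + t • s) 1 = z 1 := by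
      simp [hs, hy₀, Jet.velocity, Jet.extend, Jet.proj]
    rwa [this]
  have hline1 : ∀ t : ℝ, HasDerivAt (fun t : ℝ => y₀ + t • s) s t := fun t => by
    simpa using ((hasDerivAt_id t).smul_const s).const_add y₀
  have h1 : ∀ t : ℝ, HasDerivAt (fun t : ℝ => g (y₀ + t • s)) (fderiv ℝ g (y₀ + t • s) s) t :=
    fun t => ((hg.differentiableOn (by simp)).differentiableAt
      ((isOpen_regular 2).mem_nhds (hreg t))).hasFDerivAt.comp_hasDerivAt t (hline1 t)
  have h2 : ∀ t : ℝ, HasDerivAt (fun t : ℝ => fderiv ℝ g (y₀ + t • s) s)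
      ((2 : ℝ) • (fderiv ℝ a (Jet.velocity z) (Pi.single 1 (z 2)) • eps (z 2))) t := by
    intro t
    have h3 := ((hDgs.differentiableOn (by simp)).differentiableAt
      ((isOpen_regular 2).mem_nhds (hreg t))).hasFDerivAt.comp_hasDerivAt t (hline1 t)
    have h4 := h3.clm_apply (hasDerivAt_const t s)
    refine h4.congr_deriv ?_
    have h5 := snd_fderiv_lower hE hvar ha hg hEq (hreg t) (z 2)
    have hq : Jet.proj (Nat.le_succ 1) (y₀ + t • s) = Jet.velocity z := by
      funext i
      fin_cases i <;> simp [hs, hy₀, Jet.velocity, Jet.extend, Jet.proj]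
    rw [hq] at h5
    rw [smul_smul, map_zero, add_zero]
    exact h5
  have h3 := eq_quadratic_of_hasDerivAt h1 h2
  have hy1 : y₀ + (1 : ℝ) • s = y := by
    funext i
    fin_cases i <;> simp [hs, hy₀, hy, Jet.velocity, Jet.extend, Jet.proj]
  -- On a naturally parametrized line u̇ = ü = 0, so E reduces to g at zero acceleration.
  have hg0 : g y₀ = 0 := by
    have h4 := ((hline (z 0) (z 1) hz).2 0 (mem_univ _)).2
    rw [jetOf_line, hEq _ (by simpa using hz)] at h4
    have h5 : Jet.proj (Nat.le_succ 2) (Pi.single 0 (z 0) + Pi.single 1 (z 1) : Jet 3) = y₀ := by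
      funext i
      fin_cases i <;> simp [hy₀, Jet.velocity, Jet.extend, Jet.proj]
    rw [h5] at h4
    simpa [show eps 0 = 0 from map_zero epsL] using h4
  simp only [hy1, zero_smul, add_zero, hg0, zero_add] at h3
  rw [h3, add_comm]
  rfl

/-! ### The normal form and its remaining Helmholtz conditions -/

/-- The shape of a variational third-order system whose solutions include the straight lines. -/
structure NormalForm (E : Jet 3 → Plane) (a : Jet 1 → ℝ) (B : Jet 1 → Plane →L[ℝ] Plane) :
    Prop where
  leading_smooth : ContDiffOn ℝ ∞ a {z | z 1 ≠ 0}
  linear_smooth : ContDiffOn ℝ ∞ B {z | z 1 ≠ 0}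
  eq : ∀ z : Jet 3, z 1 ≠ 0 → E z = a (Jet.velocity z) • eps (z 3) +
    fderiv ℝ a (Jet.velocity z) (Pi.single 1 (z 2)) • eps (z 2) + B (Jet.velocity z) (z 2)

@[simp] theorem eps_zero : eps 0 = 0 := map_zero epsL

@[simp] theorem eps_neg (v : Plane) : eps (-v) = -eps v := map_neg epsL v

@[simp] theorem eps_eps (v : Plane) : eps (eps v) = -v := by
  ext i; fin_cases i <;> simp [eps]

theorem cross_eq_inner (u v : Plane) : cross u v = ⟪u, eps v⟫_ℝ := by
  rw [inner_plane, cross]; simp; ring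

theorem norm_sq_plane (u : Plane) : ‖u‖ ^ 2 = u 0 ^ 2 + u 1 ^ 2 := by
  rw [← real_inner_self_eq_norm_sq, inner_plane]; ring

namespace NormalForm

variable {E : Jet 3 → Plane} {a : Jet 1 → ℝ} {B : Jet 1 → Plane →L[ℝ] Plane}

theorem differentiableAt_leading (H : NormalForm E a B) {q : Jet 1} (hq : q 1 ≠ 0) :
    DifferentiableAt ℝ a q :=
  (H.leading_smooth.differentiableOn (by simp)).differentiableAt ((isOpen_regular 1).mem_nhds hq)

theorem differentiableAt_linear (H : NormalForm E a B) {q : Jet 1} (hq : q 1 ≠ 0) :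
    DifferentiableAt ℝ B q :=
  (H.linear_smooth.differentiableOn (by simp)).differentiableAt ((isOpen_regular 1).mem_nhds hq)

theorem differentiableAt_fderiv_leading (H : NormalForm E a B) {q : Jet 1} (hq : q 1 ≠ 0) :
    DifferentiableAt ℝ (fderiv ℝ a) q :=
  ((H.leading_smooth.fderiv_of_isOpen (isOpen_regular 1) (m := ∞) (by simp)).differentiableOn
    (by simp)).differentiableAt ((isOpen_regular 1).mem_nhds hq)

theorem snd_fderiv_symm (H : NormalForm E a B) {q : Jet 1} (hq : q 1 ≠ 0) (X Y : Jet 1) :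
    fderiv ℝ (fderiv ℝ a) q X Y = fderiv ℝ (fderiv ℝ a) q Y X :=
  ((H.leading_smooth.contDiffAt ((isOpen_regular 1).mem_nhds hq)).isSymmSndFDerivAt
    (by
      rw [minSmoothness_of_isRCLikeNormedField]
      exact WithTop.coe_le_coe.2 (le_top (a := (2 : ℕ∞))))).eq X Y

theorem fderiv_eq (H : NormalForm E a B) {z : Jet 3} (hz : z 1 ≠ 0) (X : Jet 3) :
    fderiv ℝ E z X =
      fderiv ℝ a (Jet.velocity z) (Jet.velocity X) • eps (z 3) + a (Jet.velocity z) • eps (X 3) +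
        (fderiv ℝ (fderiv ℝ a) (Jet.velocity z) (Jet.velocity X) (Pi.single 1 (z 2)) +
          fderiv ℝ a (Jet.velocity z) (Pi.single 1 (X 2))) • eps (z 2) +
        fderiv ℝ a (Jet.velocity z) (Pi.single 1 (z 2)) • eps (X 2) +
        fderiv ℝ B (Jet.velocity z) (Jet.velocity X) (z 2) + B (Jet.velocity z) (X 2) := by
  have hq : Jet.velocity z 1 ≠ 0 := hz
  have h0 := (H.differentiableAt_leading hq).hasFDerivAt.comp z Jet.velocity.hasFDerivAt
  have h1 := (H.differentiableAt_fderiv_leading hq).hasFDerivAt.comp z Jet.velocity.hasFDerivAt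
  have h2 := (H.differentiableAt_linear hq).hasFDerivAt.comp z Jet.velocity.hasFDerivAt
  have hp2 := (ContinuousLinearMap.proj (R := ℝ) (φ := fun _ : Fin 4 => Plane) 2).hasFDerivAt (x := z)
  have hs2 := ((ContinuousLinearMap.single ℝ (fun _ : Fin 2 => Plane) 1).comp
    (ContinuousLinearMap.proj (R := ℝ) (φ := fun _ : Fin 4 => Plane) 2)).hasFDerivAt (x := z)
  have he3 := (epsL.comp (ContinuousLinearMap.proj (R := ℝ) (φ := fun _ : Fin 4 => Plane)
    3)).hasFDerivAt (x := z)
  have he2 := (epsL.comp (ContinuousLinearMap.proj (R := ℝ) (φ := fun _ : Fin 4 => Plane)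
    2)).hasFDerivAt (x := z)
  have hsum := ((h0.smul he3).add ((h1.clm_apply hs2).smul he2)).add (h2.clm_apply hp2)
  have hev : E =ᶠ[nhds z] fun z => a (Jet.velocity z) • eps (z 3) +
      fderiv ℝ a (Jet.velocity z) (Pi.single 1 (z 2)) • eps (z 2) + B (Jet.velocity z) (z 2) :=
    Filter.eventuallyEq_of_mem ((isOpen_regular 3).mem_nhds hz) H.eq
  rw [(hsum.congr_of_eventuallyEq hev).fderiv]
  simp [epsL_apply]
  module

theorem coefAlong_three (H : NormalForm E a B) {j : ℝ → ℕ → Plane} {t : ℝ} (ht : j t 1 ≠ 0)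
    (e f : Plane) : coefAlong E j 3 e f t = a (Jet.trunc 1 (j t)) * ⟪eps e, f⟫_ℝ := by
  rw [coefAlong, H.fderiv_eq (by exact ht)]
  have h1 : Jet.velocity (Pi.single 3 e : Jet 3) = 0 := by
    funext s; fin_cases s <;> rfl
  have h2 : (Pi.single 3 e : Jet 3) 2 = 0 := rfl
  rw [h1, h2]
  simp [inner_smul_left]
  exact Or.inl rfl

theorem coefAlong_two (H : NormalForm E a B) {j : ℝ → ℕ → Plane} {t : ℝ} (ht : j t 1 ≠ 0)
    (e f : Plane) : coefAlong E j 2 e f t =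
      fderiv ℝ a (Jet.trunc 1 (j t)) (Pi.single 1 e) * ⟪eps (j t 2), f⟫_ℝ +
      fderiv ℝ a (Jet.trunc 1 (j t)) (Pi.single 1 (j t 2)) * ⟪eps e, f⟫_ℝ +
      ⟪B (Jet.trunc 1 (j t)) e, f⟫_ℝ := by
  rw [coefAlong, H.fderiv_eq (by exact ht)]
  have h1 : Jet.velocity (Pi.single 2 e : Jet 3) = 0 := by
    funext s; fin_cases s <;> rfl
  have h2 : (Pi.single 2 e : Jet 3) 3 = 0 := rfl
  rw [h1, h2]
  simp [inner_smul_left, inner_add_left]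
  rfl

theorem coefAlong_one (H : NormalForm E a B) {j : ℝ → ℕ → Plane} {t : ℝ} (ht : j t 1 ≠ 0)
    (e f : Plane) : coefAlong E j 1 e f t =
      fderiv ℝ a (Jet.trunc 1 (j t)) (Pi.single 1 e) * ⟪eps (j t 3), f⟫_ℝ +
      fderiv ℝ (fderiv ℝ a) (Jet.trunc 1 (j t)) (Pi.single 1 e) (Pi.single 1 (j t 2)) *
        ⟪eps (j t 2), f⟫_ℝ +
      ⟪fderiv ℝ B (Jet.trunc 1 (j t)) (Pi.single 1 e) (j t 2), f⟫_ℝ := by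
  rw [coefAlong, H.fderiv_eq (by exact ht)]
  have h1 : Jet.velocity (Pi.single 1 e : Jet 3) = Pi.single 1 e :=
    Jet.proj_single (p := 1) (q := 3) (by norm_num) 1 e
  have h2 : (Pi.single 1 e : Jet 3) 3 = 0 := rfl
  have h3 : (Pi.single 1 e : Jet 3) 2 = 0 := rfl
  rw [h1, h2, h3]
  simp [inner_smul_left, inner_add_left]
  rfl

/-- The skew-symmetric part of the linear coefficient. -/
theorem inner_linear_sub (H : NormalForm E a B) (hE : ContDiffOn ℝ ∞ E {z | z 1 ≠ 0})
    (hvar : IsVariational E) {q : Jet 1} (hq : q 1 ≠ 0) (e f : Plane) :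
    ⟪B q e, f⟫_ℝ - ⟪B q f, e⟫_ℝ = -3 * fderiv ℝ a q (Pi.single 0 (q 1)) * ⟪eps f, e⟫_ℝ := by
  obtain ⟨j, hj, hjz, hjs⟩ := exists_holonomic_of_jet q
  have h0 : j 0 1 ≠ 0 := by have := hjz 1; simp at this; rwa [this]
  have htr : Jet.trunc 1 (j 0) = q := funext hjz
  have h2 := helmholtz_two hE hvar hj h0 e f
  have hev : coefAlong E j 3 f e =ᶠ[nhds 0] fun t => a (Jet.trunc 1 (j t)) * ⟪eps f, e⟫_ℝ := by
    filter_upwards [(hj 1 0).continuousAt.eventually_ne h0] with t ht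
    exact H.coefAlong_three ht f e
  have h3 := (hj.hasDerivAt_comp_trunc (t := 0) (G := a) (by
    rw [htr]; exact H.differentiableAt_leading hq)).mul_const ⟪eps f, e⟫_ℝ
  rw [hev.deriv_eq, h3.deriv, H.coefAlong_two h0, H.coefAlong_two h0, hjs 2 (by norm_num), htr] at h2
  have h4 : (Jet.trunc 1 fun s => j 0 (s + 1)) = Pi.single 0 (q 1) := by
    funext s
    fin_cases s
    · simpa [Jet.trunc] using hjz 1
    · simpa [Jet.trunc] using hjs 2 (by norm_num)
  rw [h4] at h2
  simp at h2
  linarith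

/-- This is the first-order condition with both test vectors equal to e, at u̇ = v and ü = 0. Equal
vectors remove all terms containing eps e·e, in particular the whole third-order coefficient. -/
theorem inner_fderiv_linear (H : NormalForm E a B) (hE : ContDiffOn ℝ ∞ E {z | z 1 ≠ 0})
    (hvar : IsVariational E) {q : Jet 1} (hq : q 1 ≠ 0) (v e : Plane) :
    ⟪fderiv ℝ B q (Pi.single 1 e) v, e⟫_ℝ =
      fderiv ℝ (fderiv ℝ a) q (Pi.single 0 (q 1)) (Pi.single 1 e) * ⟪eps v, e⟫_ℝ +
      ⟪fderiv ℝ B q (Pi.single 0 (q 1)) e, e⟫_ℝ + ⟪fderiv ℝ B q (Pi.single 1 v) e, e⟫_ℝ := by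
  obtain ⟨j, hj, hjz, hjs⟩ := exists_holonomic_of_jet (q := 2)
    (Jet.extend 1 2 q + Pi.single 2 v)
  have hj0 : j 0 0 = q 0 := by simpa [Jet.extend] using hjz 0
  have hj1 : j 0 1 = q 1 := by simpa [Jet.extend] using hjz 1
  have hj2 : j 0 2 = v := by simpa [Jet.extend] using hjz 2
  have hj3 : j 0 3 = 0 := hjs 3 (by norm_num)
  have h0 : j 0 1 ≠ 0 := by rwa [hj1]
  have htr : Jet.trunc 1 (j 0) = q := by
    funext s
    fin_cases s
    · exact hj0
    · exact hj1
  have hne := (hj 1 0).continuousAt.eventually_ne h0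
  have h2 := helmholtz_one hE hvar hj h0 e e
  have hev3 : coefAlong E j 3 e e =ᶠ[nhds 0] fun _ => 0 := by
    filter_upwards [hne] with t ht
    rw [H.coefAlong_three ht, inner_eps_self, mul_zero]
  have hd3 : deriv (deriv (coefAlong E j 3 e e)) 0 = 0 := by
    rw [(hev3.deriv).deriv_eq]
    simp
  have hev2 : coefAlong E j 2 e e =ᶠ[nhds 0] fun t =>
      fderiv ℝ a (Jet.trunc 1 (j t)) (Pi.single 1 e) * ⟪eps (j t 2), e⟫_ℝ +
        ⟪B (Jet.trunc 1 (j t)) e, e⟫_ℝ := by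
    filter_upwards [hne] with t ht
    rw [H.coefAlong_two ht, inner_eps_self, mul_zero, add_zero]
  have h4 : (Jet.trunc 1 fun s => j 0 (s + 1)) = Pi.single 0 (q 1) + Pi.single 1 v := by
    funext s
    fin_cases s
    · simpa [Jet.trunc] using hj1
    · simpa [Jet.trunc] using hj2
  have ha' := hj.hasDerivAt_comp_trunc (t := 0) (G := fderiv ℝ a) (by
    rw [htr]; exact H.differentiableAt_fderiv_leading hq)
  have hB' := hj.hasDerivAt_comp_trunc (t := 0) (G := B) (by
    rw [htr]; exact H.differentiableAt_linear hq)
  have he' := epsL.hasFDerivAt.comp_hasDerivAt (0 : ℝ) (hj 2 0)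
  have hd2 := (((ha'.clm_apply (hasDerivAt_const (0 : ℝ) (Pi.single 1 e : Jet 1))).mul
    (he'.inner ℝ (hasDerivAt_const (0 : ℝ) e))).add
      ((hB'.clm_apply (hasDerivAt_const (0 : ℝ) e)).inner ℝ (hasDerivAt_const (0 : ℝ) e))).deriv
  have hd2' := hev2.deriv_eq.trans hd2
  rw [hd3, hd2', H.coefAlong_one h0, hj3, hj2, htr, h4] at h2
  simp [epsL_apply, hj2, inner_add_left] at h2
  rw [H.snd_fderiv_symm hq (Pi.single 1 v)] at h2
  linarith

end NormalForm

/-! ### Consequences of the conserved curvature -/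

theorem inner_eps_left (u v : Plane) : ⟪eps u, v⟫_ℝ = -⟪u, eps v⟫_ℝ := by
  simp [inner_plane]

theorem ne_zero_sq_pos {u : Plane} (hu : u ≠ 0) : 0 < u 0 ^ 2 + u 1 ^ 2 := by
  rw [← norm_sq_plane]; positivity

/-- Where the curvature is stationary, the third derivative is constrained. -/
theorem cross_of_totalDeriv_eq_zero {z : Jet 3} (hc : cross (z 1) (z 2) ≠ 0)
    (h : totalDeriv frenetCurvature z = 0) :
    cross (z 1) (z 3) * ‖z 1‖ ^ 2 = 3 * cross (z 1) (z 2) * ⟪z 1, z 2⟫_ℝ := by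
  have hu : z 1 ≠ 0 := by
    rintro hu; simp [hu, cross] at hc
  obtain ⟨j, hj, hjz, -⟩ := exists_holonomic_of_jet z
  have e1 : j 0 1 = z 1 := by simpa using hjz 1
  have e2 : j 0 2 = z 2 := by simpa using hjz 2
  have e3 : j 0 3 = z 3 := by simpa using hjz 3
  have htr : Jet.trunc 3 (j 0) = z := funext hjz
  have hdiff : DifferentiableAt ℝ frenetCurvature (Jet.trunc 2 (j 0)) := by
    have hcr : DifferentiableAt ℝ (fun z : Jet 2 => cross (z 1) (z 2)) (Jet.trunc 2 (j 0)) := by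
      unfold cross; fun_prop
    have hcr0 : cross (Jet.trunc 2 (j 0) 1) (Jet.trunc 2 (j 0) 2) ≠ 0 := by
      show cross (j 0 1) (j 0 2) ≠ 0
      rwa [e1, e2]
    have hu0 : Jet.trunc 2 (j 0) 1 ≠ 0 := by
      show j 0 1 ≠ 0
      rwa [e1]
    have hn : DifferentiableAt ℝ (fun z : Jet 2 => ‖z 1‖) (Jet.trunc 2 (j 0)) :=
      DifferentiableAt.norm ℝ (by fun_prop) hu0
    show DifferentiableAt ℝ (fun z : Jet 2 => |cross (z 1) (z 2)| / ‖z 1‖ ^ 3) _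
    simp only [div_eq_mul_inv]
    exact (hcr.abs hcr0).fun_mul ((hn.fun_pow 3).fun_inv (pow_ne_zero 3 (norm_ne_zero_iff.2 hu0)))
  have hk := hj.hasDerivAt_comp_trunc (t := 0) hdiff
  have hz0 : fderiv ℝ frenetCurvature (Jet.trunc 2 (j 0)) (Jet.trunc 2 fun s => j 0 (s + 1)) = 0 := by
    rw [← htr] at h
    exact h
  rw [hz0] at hk
  -- The square of k is a rational function of the coordinates, so the absolute value and the square
  -- root disappear.
  have hk2 := hk.pow 2
  simp only [mul_zero] at hk2
  have hcoord : ∀ (s : ℕ) (i : Fin 2), HasDerivAt (fun t => j t s i) (j 0 (s + 1) i) 0 := by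
    intro s i
    exact (EuclideanSpace.proj (𝕜 := ℝ) i).hasFDerivAt.comp_hasDerivAt (0 : ℝ) (hj s 0)
  have hcd := ((hcoord 1 0).mul (hcoord 2 1)).sub ((hcoord 1 1).mul (hcoord 2 0))
  have hnd := ((hcoord 1 0).pow 2).add ((hcoord 1 1).pow 2)
  have hnpos : 0 < j 0 1 0 ^ 2 + j 0 1 1 ^ 2 := by
    rw [e1]; exact ne_zero_sq_pos hu
  have hq := (hcd.pow 2).div (hnd.pow 3) (pow_ne_zero 3 hnpos.ne')
  have heq : (fun t => frenetCurvature (Jet.trunc 2 (j t))) ^ 2 = fun t =>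
      (j t 1 0 * j t 2 1 - j t 1 1 * j t 2 0) ^ 2 / (j t 1 0 ^ 2 + j t 1 1 ^ 2) ^ 3 := by
    funext t
    show (|cross (j t 1) (j t 2)| / ‖j t 1‖ ^ 3) ^ 2 = _
    rw [div_pow, sq_abs, ← norm_sq_plane, cross]
    ring
  rw [heq] at hk2
  have huniq := hk2.unique hq
  simp only [Pi.pow_apply, Pi.mul_apply, Pi.sub_apply, Pi.add_apply,
    Nat.reduceAdd, Nat.reduceSub, pow_one, Nat.cast_ofNat, e1, e2, e3] at huniq hnpos
  rw [eq_comm, div_eq_zero_iff, or_iff_left (by positivity)] at huniq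
  have hc0 : z 1 0 * z 2 1 - z 1 1 * z 2 0 ≠ 0 := hc
  rw [norm_sq_plane, inner_plane, cross, cross]
  -- The derivative of (u∧u̇)²/(‖u‖²)³ has a numerator divisible by (u∧u̇)‖u‖⁴, which is nonzero
  -- here.
  refine mul_left_cancel₀ (mul_ne_zero hc0 (pow_ne_zero 2 hnpos.ne')) ?_
  linear_combination huniq / 2

namespace NormalForm

variable {E : Jet 3 → Plane} {a : Jet 1 → ℝ} {B : Jet 1 → Plane →L[ℝ] Plane}

/-- The third derivative that solves the system. -/
theorem exists_solution (H : NormalForm E a B) {q : Jet 1} (hq : q 1 ≠ 0) (ha : a q ≠ 0)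
    (v : Plane) : ∃ z : Jet 3, Jet.velocity z = q ∧ z 1 = q 1 ∧ z 2 = v ∧
      a q • eps (z 3) = -(fderiv ℝ a q (Pi.single 1 v) • eps v + B q v) ∧ E z = 0 := by
  set y := fderiv ℝ a q (Pi.single 1 v) • eps v + B q v with hy
  refine ⟨![q 0, q 1, v, (a q)⁻¹ • eps y], ?_, rfl, rfl, ?_, ?_⟩
  · funext s; fin_cases s <;> rfl
  · show a q • eps ((a q)⁻¹ • eps y) = -y
    rw [eps_smul, eps_eps, smul_smul, mul_inv_cancel₀ ha, one_smul]
  · have hv : Jet.velocity ![q 0, q 1, v, (a q)⁻¹ • eps y] = q := by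
      funext s; fin_cases s <;> rfl
    rw [H.eq _ (by exact hq), hv]
    show a q • eps ((a q)⁻¹ • eps y) + fderiv ℝ a q (Pi.single 1 v) • eps v + B q v = 0
    rw [eps_smul, eps_eps, smul_smul, mul_inv_cancel₀ ha, one_smul, add_assoc, ← hy]
    abel

/-- Substituting the solved ü into the stationarity of k gives an identity in v. One part is
quadratic in v and the other cubic-free and linear, so comparison at v and −v separates them. -/
theorem first_integral_consequences (H : NormalForm E a B) (hint : CurvatureIsFirstIntegral E)
    {q : Jet 1} (hq : q 1 ≠ 0) (ha : a q ≠ 0) {v : Plane} (hv : cross (q 1) v ≠ 0) :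
    fderiv ℝ a q (Pi.single 1 v) * ‖q 1‖ ^ 2 = -3 * a q * ⟪q 1, v⟫_ℝ ∧ ⟪q 1, B q v⟫_ℝ = 0 := by
  have key : ∀ v : Plane, cross (q 1) v ≠ 0 →
      (fderiv ℝ a q (Pi.single 1 v) * ‖q 1‖ ^ 2 + 3 * a q * ⟪q 1, v⟫_ℝ) * cross (q 1) v +
        ‖q 1‖ ^ 2 * ⟪q 1, B q v⟫_ℝ = 0 := by
    intro v hv
    obtain ⟨z, -, h1, h2, h3, h0⟩ := H.exists_solution hq ha v
    have hk := cross_of_totalDeriv_eq_zero (z := z) (by rwa [h1, h2])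
      (hint z (by rwa [h1, h2]) h0)
    rw [h1, h2] at hk
    have h4 := congrArg (fun x => ⟪q 1, x⟫_ℝ) h3
    simp only [inner_smul_right, inner_neg_right, inner_add_right, ← cross_eq_inner] at h4
    linear_combination (‖q 1‖ ^ 2) * h4 - a q * hk
  have k1 := key v hv
  have k2 := key (-v) (by rw [cross_eq_inner] at hv ⊢; simpa using hv)
  have hc : cross (q 1) (-v) = -cross (q 1) v := by simp [cross_eq_inner]
  rw [hc, Pi.single_neg, map_neg, map_neg, inner_neg_right, inner_neg_right] at k2
  have hn : ‖q 1‖ ^ 2 ≠ 0 := pow_ne_zero 2 (norm_ne_zero_iff.2 hq)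
  constructor
  · have : (fderiv ℝ a q (Pi.single 1 v) * ‖q 1‖ ^ 2 + 3 * a q * ⟪q 1, v⟫_ℝ) * cross (q 1) v = 0 := by
      linarith
    have := (mul_eq_zero.1 this).resolve_right hv
    linarith
  · have : ‖q 1‖ ^ 2 * ⟪q 1, B q v⟫_ℝ = 0 := by linarith
    exact (mul_eq_zero.1 this).resolve_left hn

/-- A vector parallel to u is the difference of two vectors not parallel to u, v + eps u and eps u,
so additivity extends the equality to it. -/
theorem eq_of_cross_ne_zero {u : Plane} (hu : u ≠ 0) {ℓ ℓ' : Plane → ℝ}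
    (hl : ∀ v w, ℓ (v + w) = ℓ v + ℓ w) (hl' : ∀ v w, ℓ' (v + w) = ℓ' v + ℓ' w)
    (h : ∀ v, cross u v ≠ 0 → ℓ v = ℓ' v) (v : Plane) : ℓ v = ℓ' v := by
  have hn : cross u (eps u) ≠ 0 := by
    simpa [cross_eq_inner] using hu
  by_cases hv : cross u v = 0
  · have h1 := h (v + eps u) (by
      rw [cross_eq_inner] at *
      rw [show eps (v + eps u) = eps v + eps (eps u) from map_add epsL _ _, inner_add_right, hv,
        zero_add]
      exact hn)
    have h2 := h _ hn
    rw [hl, hl'] at h1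
    linarith
  · exact h v hv

theorem fderiv_leading_velocity (H : NormalForm E a B) (hint : CurvatureIsFirstIntegral E)
    {q : Jet 1} (hq : q 1 ≠ 0) (ha : a q ≠ 0) (v : Plane) :
    fderiv ℝ a q (Pi.single 1 v) * ‖q 1‖ ^ 2 = -3 * a q * ⟪q 1, v⟫_ℝ := by
  refine eq_of_cross_ne_zero hq (ℓ := fun v => fderiv ℝ a q (Pi.single 1 v) * ‖q 1‖ ^ 2)
    (ℓ' := fun v => -3 * a q * ⟪q 1, v⟫_ℝ) ?_ ?_
    (fun v hv => (H.first_integral_consequences hint hq ha hv).1) v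
  · intro v w
    simp only [Pi.single_add, map_add]; ring
  · intro v w
    simp only [inner_add_right]; ring

theorem inner_velocity_linear (H : NormalForm E a B) (hint : CurvatureIsFirstIntegral E)
    {q : Jet 1} (hq : q 1 ≠ 0) (ha : a q ≠ 0) (v : Plane) : ⟪q 1, B q v⟫_ℝ = 0 := by
  refine eq_of_cross_ne_zero hq (ℓ := fun v => ⟪q 1, B q v⟫_ℝ) (ℓ' := fun _ => 0) ?_ ?_
    (fun v hv => (H.first_integral_consequences hint hq ha hv).2) v
  · intro v w
    simp only [map_add, inner_add_right]
  · intro v w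
    simp

theorem eventually_leading_ne_zero (H : NormalForm E a B) {q : Jet 1} (hq : q 1 ≠ 0)
    (ha : a q ≠ 0) : ∀ᶠ q' in nhds q, q' 1 ≠ 0 ∧ a q' ≠ 0 :=
  Filter.Eventually.and ((isOpen_regular 1).mem_nhds hq) ((H.differentiableAt_leading hq).continuousAt.eventually_ne ha)

/-- The mixed second derivatives of the leading coefficient. -/
theorem snd_fderiv_leading (H : NormalForm E a B) (hint : CurvatureIsFirstIntegral E)
    {q : Jet 1} (hq : q 1 ≠ 0) (ha : a q ≠ 0) (χ v : Plane) :
    fderiv ℝ (fderiv ℝ a) q (Pi.single 0 χ) (Pi.single 1 v) * ‖q 1‖ ^ 2 =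
      -3 * fderiv ℝ a q (Pi.single 0 χ) * ⟪q 1, v⟫_ℝ := by
  have hline : HasDerivAt (fun t : ℝ => q + t • (Pi.single 0 χ : Jet 1)) (Pi.single 0 χ) 0 := by
    simpa using ((hasDerivAt_id (0 : ℝ)).smul_const (Pi.single 0 χ : Jet 1)).const_add q
  have hq0 : q + (0 : ℝ) • (Pi.single 0 χ : Jet 1) = q := by simp
  have h1 := ((hq0.symm ▸ H.differentiableAt_fderiv_leading hq :
    DifferentiableAt ℝ (fderiv ℝ a) (q + (0 : ℝ) • (Pi.single 0 χ : Jet 1))).hasFDerivAt.comp_hasDerivAt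
      (0 : ℝ) hline)
  have h2 := ((hq0.symm ▸ H.differentiableAt_leading hq :
    DifferentiableAt ℝ a (q + (0 : ℝ) • (Pi.single 0 χ : Jet 1))).hasFDerivAt.comp_hasDerivAt (0 : ℝ) hline)
  rw [hq0] at h1 h2
  have h3 := (h1.clm_apply (hasDerivAt_const (0 : ℝ) (Pi.single 1 v : Jet 1))).mul_const (‖q 1‖ ^ 2)
  have h4 := (h2.const_mul (-3)).mul_const ⟪q 1, v⟫_ℝ
  have hev := hline.continuousAt.eventually (p := fun q' : Jet 1 => q' 1 ≠ 0 ∧ a q' ≠ 0) (by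
    show ∀ᶠ y in nhds (q + (0 : ℝ) • (Pi.single 0 χ : Jet 1)), y 1 ≠ 0 ∧ a y ≠ 0
    rw [hq0]; exact H.eventually_leading_ne_zero hq ha)
  have hev2 : (fun t : ℝ => fderiv ℝ a (q + t • (Pi.single 0 χ : Jet 1)) (Pi.single 1 v) * ‖q 1‖ ^ 2)
      =ᶠ[nhds 0] fun t => -3 * a (q + t • (Pi.single 0 χ : Jet 1)) * ⟪q 1, v⟫_ℝ := by
    filter_upwards [hev] with t ht
    have := H.fderiv_leading_velocity hint ht.1 ht.2 v
    simpa using this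
  have h5 := h4.congr_of_eventuallyEq hev2
  have := h3.unique h5
  simpa using this

/-! ### Consequences of Euclidean symmetry -/

/-- Euclidean symmetry at a solution, applied to the generator of translations. -/
theorem translation_symmetry (H : NormalForm E a B) (hsymm : HasEuclideanSymmetry E)
    {q : Jet 1} (hq : q 1 ≠ 0) (ha : a q ≠ 0) (χ v : Plane) :
    a q • (fderiv ℝ (fderiv ℝ a) q (Pi.single 0 χ) (Pi.single 1 v) • eps v +
        fderiv ℝ B q (Pi.single 0 χ) v) =
      fderiv ℝ a q (Pi.single 0 χ) • (fderiv ℝ a q (Pi.single 1 v) • eps v + B q v) := by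
  obtain ⟨z, h0, h1, h2, h3, hz⟩ := H.exists_solution hq ha v
  have h := hsymm χ 0 z (by rwa [h1]) hz
  rw [H.fderiv_eq (by rwa [h1]), h0] at h
  have hX : Jet.velocity (euclideanGenerator χ 0 z) = Pi.single 0 χ := by
    funext s; fin_cases s
    · simp [Jet.velocity, Jet.proj, euclideanGenerator]
    · simp [Jet.velocity, Jet.proj, euclideanGenerator]
  have hX2 : euclideanGenerator χ 0 z 2 = 0 := by simp [euclideanGenerator]
  have hX3 : euclideanGenerator χ 0 z 3 = 0 := by simp [euclideanGenerator]
  rw [hX, hX2, hX3, h2] at h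
  simp only [eps_zero, smul_zero, add_zero, Pi.single_zero, map_zero] at h
  have h4 := congrArg (fun x => a q • x) h
  have h5 := congrArg (fun x => fderiv ℝ a q (Pi.single 0 χ) • x) h3
  simp only [smul_add, smul_zero, smul_neg] at h4 h5 ⊢
  rw [smul_comm (a q) (fderiv ℝ a q (Pi.single 0 χ)), h5] at h4
  rw [← sub_eq_zero, ← h4]
  abel

/-- Euclidean symmetry at a solution, applied to the rotation about its position. -/
theorem rotation_symmetry (H : NormalForm E a B) (hint : CurvatureIsFirstIntegral E)
    (hsymm : HasEuclideanSymmetry E)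
    {q : Jet 1} (hq : q 1 ≠ 0) (ha : a q ≠ 0) (v : Plane) :
    fderiv ℝ B q (Pi.single 1 (eps (q 1))) v + B q (eps v) - eps (B q v) = 0 := by
  have key : ∀ v : Plane,
      fderiv ℝ (fderiv ℝ a) q (Pi.single 1 (eps (q 1))) (Pi.single 1 v) • eps v +
        fderiv ℝ a q (Pi.single 1 (eps v)) • eps v +
        (fderiv ℝ B q (Pi.single 1 (eps (q 1))) v + B q (eps v) - eps (B q v)) = 0 := by
    intro v
    obtain ⟨z, h0, h1, h2, h3, hz⟩ := H.exists_solution hq ha v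
    have h := hsymm (-eps (z 0)) (-1) z (by rwa [h1]) hz
    rw [H.fderiv_eq (by rwa [h1]), h0] at h
    have hX : Jet.velocity (euclideanGenerator (-eps (z 0)) (-1) z) = Pi.single 1 (eps (q 1)) := by
      funext s; fin_cases s
      · simp [Jet.velocity, Jet.proj, euclideanGenerator]
      · simp [Jet.velocity, Jet.proj, euclideanGenerator, h1]
    have hX2 : euclideanGenerator (-eps (z 0)) (-1) z 2 = eps v := by
      simp [euclideanGenerator, h2]
    have hX3 : euclideanGenerator (-eps (z 0)) (-1) z 3 = eps (z 3) := by
      simp [euclideanGenerator]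
    have hrad : fderiv ℝ a q (Pi.single 1 (eps (q 1))) = 0 := by
      have := H.fderiv_leading_velocity hint hq ha (eps (q 1))
      rw [real_inner_comm, inner_eps_self, mul_zero] at this
      exact (mul_eq_zero.1 this).resolve_right (pow_ne_zero 2 (norm_ne_zero_iff.2 hq))
    have h5 := congrArg epsL h3
    rw [map_smul, map_neg, map_add, map_smul] at h5
    simp only [epsL_apply] at h5
    rw [hX, hX2, hX3, h2, hrad, h5] at h
    rw [← h]
    simp only [zero_smul]
    module
  have k1 := key v
  have k2 := key (-v)
  simp only [Pi.single_neg, map_neg, eps_neg, neg_smul, smul_neg, neg_neg] at k1 k2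
  have h3 : (2 : ℝ) • (fderiv ℝ B q (Pi.single 1 (eps (q 1))) v + B q (eps v) - eps (B q v)) =
      0 := by
    refine Eq.trans ?_ ((congrArg₂ (fun x y : Plane => x - y) k1 k2).trans (sub_self 0))
    module
  exact (smul_eq_zero.1 h3).resolve_left two_ne_zero

end NormalForm

theorem isPreconnected_regular : IsPreconnected {q : Jet 1 | q 1 ≠ 0} := by
  have hrank : 1 < Module.rank ℝ Plane := by
    rw [← Module.finrank_eq_rank, finrank_euclideanSpace_fin]
    norm_num
  have h1 : IsPreconnected ({0}ᶜ : Set Plane) :=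
    (isConnected_compl_singleton_of_one_lt_rank hrank 0).isPreconnected
  have h2 := (isPreconnected_univ (α := Plane)).prod h1
  have h3 := h2.image (fun p : Plane × Plane => (![p.1, p.2] : Jet 1)) (by
    refine Continuous.continuousOn (continuous_pi fun i => ?_)
    fin_cases i
    · exact continuous_fst
    · exact continuous_snd)
  convert h3 using 1
  ext q
  constructor
  · intro hq
    refine ⟨(q 0, q 1), ⟨mem_univ _, hq⟩, ?_⟩
    funext i
    fin_cases i <;> rfl
  · rintro ⟨p, ⟨-, hp⟩, rfl⟩
    exact hp

/-- A continuous function on the regular velocities is constant if the derivative of its square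
vanishes. -/
theorem exists_eq_const_of_sq {F G : Jet 1 → ℝ} (hF : ContinuousOn F {q | q 1 ≠ 0})
    (hFG : ∀ q : Jet 1, q 1 ≠ 0 → F q ^ 2 = G q) (hG : DifferentiableOn ℝ G {q | q 1 ≠ 0})
    (hG' : ∀ q : Jet 1, q 1 ≠ 0 → fderiv ℝ G q = 0) : ∃ c, ∀ q : Jet 1, q 1 ≠ 0 → F q = c := by
  obtain ⟨C, hC⟩ := (isOpen_regular 1).exists_is_const_of_fderiv_eq_zero isPreconnected_regular hG hG'
  by_cases h0 : ∃ q : Jet 1, q 1 ≠ 0 ∧ F q ≠ 0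
  · obtain ⟨q₀, hq₀, hne⟩ := h0
    refine ⟨F q₀, fun q hq => ?_⟩
    refine isPreconnected_regular.eq_of_sq_eq (f := F) (g := fun _ => F q₀) hF continuousOn_const
      (fun q hq => ?_) (fun _ => hne) hq₀ rfl hq
    show F q ^ 2 = F q₀ ^ 2
    rw [hFG q hq, hFG q₀ hq₀, hC q hq, hC q₀ hq₀]
  · push Not at h0
    exact ⟨0, h0⟩

theorem norm_sq_smul_eq (u v : Plane) :
    ‖u‖ ^ 2 • v = ⟪u, v⟫_ℝ • u + ⟪eps u, v⟫_ℝ • eps u := by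
  ext i
  rw [norm_sq_plane]
  fin_cases i <;> simp [inner_plane] <;> ring

theorem jet_one_eq (X : Jet 1) : X = Pi.single 0 (X 0) + Pi.single 1 (X 1) := by
  funext i
  fin_cases i <;> simp

namespace NormalForm

variable {E : Jet 3 → Plane} {a : Jet 1 → ℝ} {B : Jet 1 → Plane →L[ℝ] Plane}

theorem hasFDerivAt_inner_linear (H : NormalForm E a B) {q : Jet 1} (hq : q 1 ≠ 0) (e f : Plane) :
    HasFDerivAt (fun q => ⟪B q e, f⟫_ℝ)
      ((innerSL ℝ f).comp ((ContinuousLinearMap.apply ℝ Plane e).comp (fderiv ℝ B q))) q := by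
  have h1 := (ContinuousLinearMap.apply ℝ Plane e).hasFDerivAt.comp q
    (H.differentiableAt_linear hq).hasFDerivAt
  have h2 := (innerSL ℝ f).hasFDerivAt.comp q h1
  refine h2.congr_of_eventuallyEq (Filter.Eventually.of_forall fun q => ?_)
  simp [real_inner_comm]

theorem fderiv_leading_position_comp (H : NormalForm E a B) {q : Jet 1} (hq : q 1 ≠ 0)
    (L : Jet 1 →L[ℝ] Plane) (X : Jet 1) :
    fderiv ℝ (fun q => fderiv ℝ a q (Pi.single 0 (L q))) q X =
      fderiv ℝ (fderiv ℝ a) q X (Pi.single 0 (L q)) + fderiv ℝ a q (Pi.single 0 (L X)) := by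
  have h1 := (H.differentiableAt_fderiv_leading hq).hasFDerivAt.clm_apply
    ((ContinuousLinearMap.single ℝ (fun _ : Fin 2 => Plane) 0).comp L).hasFDerivAt
  have h2 := DFunLike.congr_fun h1.fderiv X
  refine h2.trans ?_
  simp
  ring

/-- The direction normal to the velocity. -/
noncomputable def normalL : Jet 1 →L[ℝ] Plane :=
  epsL.comp (ContinuousLinearMap.proj (R := ℝ) (φ := fun _ : Fin 2 => Plane) 1)

theorem fderiv_leading_normal (H : NormalForm E a B) (hE : ContDiffOn ℝ ∞ E {z | z 1 ≠ 0})
    (hvar : IsVariational E) (hint : CurvatureIsFirstIntegral E) (hsymm : HasEuclideanSymmetry E)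
    {q : Jet 1} (hq : q 1 ≠ 0) (ha : a q ≠ 0) :
    fderiv ℝ a q (Pi.single 0 (eps (q 1))) = 0 := by
  set e₀ : Plane := !₂[1, 0] with he₀
  set e₁ : Plane := !₂[0, 1] with he₁
  have hee : ⟪eps e₁, e₀⟫_ℝ = 1 := by simp [inner_plane, e₀, e₁]
  have hev : (fun q => ⟪B q e₀, e₁⟫_ℝ - ⟪B q e₁, e₀⟫_ℝ) =ᶠ[nhds q] fun q =>
      (-3) * fderiv ℝ a q (Pi.single 0
        (ContinuousLinearMap.proj (R := ℝ) (φ := fun _ : Fin 2 => Plane) 1 q)) := by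
    filter_upwards [(isOpen_regular 1).mem_nhds hq] with q' hq'
    rw [H.inner_linear_sub hE hvar hq', hee, mul_one]
    rfl
  have h1 := DFunLike.congr_fun (hev.fderiv_eq (𝕜 := ℝ)) (Pi.single 1 (eps (q 1)))
  rw [((H.hasFDerivAt_inner_linear hq e₀ e₁).fun_sub (H.hasFDerivAt_inner_linear hq e₁ e₀)).fderiv] at h1
  have hd : DifferentiableAt ℝ (fun q => fderiv ℝ a q (Pi.single 0
        (ContinuousLinearMap.proj (R := ℝ) (φ := fun _ : Fin 2 => Plane) 1 q))) q :=
    ((H.differentiableAt_fderiv_leading hq).hasFDerivAt.clm_apply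
    ((ContinuousLinearMap.single ℝ (fun _ : Fin 2 => Plane) 0).comp
      (ContinuousLinearMap.proj (R := ℝ) (φ := fun _ : Fin 2 => Plane) 1)).hasFDerivAt).differentiableAt
  rw [fderiv_const_mul hd, smul_apply, H.fderiv_leading_position_comp hq,
    H.snd_fderiv_symm hq] at h1
  have h2 := H.snd_fderiv_leading hint hq ha (q 1) (eps (q 1))
  rw [real_inner_comm, inner_eps_self, mul_zero] at h2
  have h3 := (mul_eq_zero.1 h2).resolve_right (pow_ne_zero 2 (norm_ne_zero_iff.2 hq))
  have r0 := H.rotation_symmetry hint hsymm hq ha e₀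
  have r1 := H.rotation_symmetry hint hsymm hq ha e₁
  have s0 : eps e₀ = -e₁ := by ext i; fin_cases i <;> simp [e₀, e₁]
  have s1 : eps e₁ = e₀ := by ext i; fin_cases i <;> simp [e₀, e₁]
  rw [s0, map_neg] at r0
  rw [s1] at r1
  have r01 := congrArg (fun x : Plane => x 1) r0
  have r10 := congrArg (fun x : Plane => x 0) r1
  have hproj : (ContinuousLinearMap.proj (R := ℝ) (φ := fun _ : Fin 2 => Plane) 1 q) = q 1 := rfl
  rw [hproj, h3] at h1
  simp [inner_plane, e₀, e₁] at h1 r01 r10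
  simp only [e₀, e₁] at *
  linarith

theorem fderiv_leading_tangent (H : NormalForm E a B) (hE : ContDiffOn ℝ ∞ E {z | z 1 ≠ 0})
    (hvar : IsVariational E) (hint : CurvatureIsFirstIntegral E) (hsymm : HasEuclideanSymmetry E)
    {q : Jet 1} (hq : q 1 ≠ 0) (ha : a q ≠ 0) : fderiv ℝ a q (Pi.single 0 (q 1)) = 0 := by
  have hev : (fun q => fderiv ℝ a q (Pi.single 0 (normalL q))) =ᶠ[nhds q] fun _ => 0 := by
    filter_upwards [H.eventually_leading_ne_zero hq ha] with q' hq'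
    exact H.fderiv_leading_normal hE hvar hint hsymm hq'.1 hq'.2
  have h1 := DFunLike.congr_fun (hev.fderiv_eq (𝕜 := ℝ)) (Pi.single 1 (eps (q 1)))
  rw [H.fderiv_leading_position_comp hq, H.snd_fderiv_symm hq] at h1
  have h2 := H.snd_fderiv_leading hint hq ha (eps (q 1)) (eps (q 1))
  rw [real_inner_comm, inner_eps_self, mul_zero] at h2
  have h3 := (mul_eq_zero.1 h2).resolve_right (pow_ne_zero 2 (norm_ne_zero_iff.2 hq))
  have h4 : normalL q = eps (q 1) := rfl
  have h5 : normalL (Pi.single 1 (eps (q 1))) = -q 1 := by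
    simp [normalL, epsL_apply]
  rw [h4, h3, h5, Pi.single_neg, map_neg] at h1
  simpa using h1

theorem fderiv_leading_position (H : NormalForm E a B) (hE : ContDiffOn ℝ ∞ E {z | z 1 ≠ 0})
    (hvar : IsVariational E) (hint : CurvatureIsFirstIntegral E) (hsymm : HasEuclideanSymmetry E)
    {q : Jet 1} (hq : q 1 ≠ 0) (ha : a q ≠ 0) (χ : Plane) :
    fderiv ℝ a q (Pi.single 0 χ) = 0 := by
  have h := congrArg (fun x : Plane => fderiv ℝ a q (Pi.single 0 x)) (norm_sq_smul_eq (q 1) χ)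
  simp only [Pi.single_add, Pi.single_smul, map_add, map_smul,
    H.fderiv_leading_normal hE hvar hint hsymm hq ha,
    H.fderiv_leading_tangent hE hvar hint hsymm hq ha, mul_zero, add_zero, smul_eq_mul] at h
  exact (mul_eq_zero.1 h).resolve_left (pow_ne_zero 2 (norm_ne_zero_iff.2 hq))

theorem exists_leading_eq (H : NormalForm E a B) (hE : ContDiffOn ℝ ∞ E {z | z 1 ≠ 0})
    (hvar : IsVariational E) (hint : CurvatureIsFirstIntegral E) (hsymm : HasEuclideanSymmetry E)
    (hthird : IsThirdOrder E) :
    ∃ α : ℝ, α ≠ 0 ∧ ∀ q : Jet 1, q 1 ≠ 0 → a q * ‖q 1‖ ^ 3 = α := by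
  have hder : ∀ q : Jet 1, q 1 ≠ 0 → HasFDerivAt (fun q : Jet 1 => a q ^ 2 * (‖q 1‖ ^ 2) ^ 3)
      (0 : Jet 1 →L[ℝ] ℝ) q := by
    intro q hq
    have h1 := (H.differentiableAt_leading hq).hasFDerivAt.pow 2
    have h2 := (((ContinuousLinearMap.proj (R := ℝ) (φ := fun _ : Fin 2 => Plane)
      1).hasFDerivAt (x := q)).norm_sq).pow 3
    refine (h1.mul h2).congr_fderiv ?_
    ext1 X
    by_cases ha : a q = 0
    · simp [ha]
    · have h3 := H.fderiv_leading_velocity hint hq ha (X 1)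
      have h4 : fderiv ℝ a q X = fderiv ℝ a q (Pi.single 1 (X 1)) := by
        conv_lhs => rw [jet_one_eq X, map_add]
        rw [H.fderiv_leading_position hE hvar hint hsymm hq ha, zero_add]
      simp [h4]
      linear_combination 2 * a q * ‖q 1‖ ^ 4 * h3
  obtain ⟨α, hα⟩ := exists_eq_const_of_sq (F := fun q => a q * ‖q 1‖ ^ 3)
    (G := fun q => a q ^ 2 * (‖q 1‖ ^ 2) ^ 3)
    (H.leading_smooth.continuousOn.mul (by fun_prop)) (fun q _ => by ring)
    (fun q hq => (hder q hq).differentiableAt.differentiableWithinAt) (fun q hq => (hder q hq).fderiv)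
  refine ⟨α, ?_, hα⟩
  rintro rfl
  obtain ⟨z, w, hz, hne⟩ := hthird
  have ha : a (Jet.velocity z) = 0 :=
    (mul_eq_zero.1 (hα (Jet.velocity z) hz)).resolve_right (pow_ne_zero 3 (norm_ne_zero_iff.2 hz))
  refine hne ?_
  have hv : Jet.velocity (Function.update z 3 w) = Jet.velocity z := by
    funext i; fin_cases i <;> rfl
  rw [H.eq z hz, H.eq _ (by simpa using hz), hv, ha]
  simp

end NormalForm

namespace NormalForm

variable {E : Jet 3 → Plane} {a : Jet 1 → ℝ} {B : Jet 1 → Plane →L[ℝ] Plane}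

theorem inner_linear_comm (H : NormalForm E a B) (hE : ContDiffOn ℝ ∞ E {z | z 1 ≠ 0})
    (hvar : IsVariational E) (hint : CurvatureIsFirstIntegral E) (hsymm : HasEuclideanSymmetry E)
    {q : Jet 1} (hq : q 1 ≠ 0) (ha : a q ≠ 0) (e f : Plane) : ⟪B q e, f⟫_ℝ = ⟪B q f, e⟫_ℝ := by
  have h := H.inner_linear_sub hE hvar hq e f
  rw [H.fderiv_leading_tangent hE hvar hint hsymm hq ha] at h
  linarith

theorem inner_fderiv_linear_comm (H : NormalForm E a B) (hE : ContDiffOn ℝ ∞ E {z | z 1 ≠ 0})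
    (hvar : IsVariational E) (hint : CurvatureIsFirstIntegral E) (hsymm : HasEuclideanSymmetry E)
    {q : Jet 1} (hq : q 1 ≠ 0) (ha : a q ≠ 0) (X : Jet 1) (e f : Plane) :
    ⟪fderiv ℝ B q X e, f⟫_ℝ = ⟪fderiv ℝ B q X f, e⟫_ℝ := by
  have hev : (fun q => ⟪B q e, f⟫_ℝ) =ᶠ[nhds q] fun q => ⟪B q f, e⟫_ℝ := by
    filter_upwards [H.eventually_leading_ne_zero hq ha] with q' hq'
    exact H.inner_linear_comm hE hvar hint hsymm hq'.1 hq'.2 e f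
  have h1 := DFunLike.congr_fun (hev.fderiv_eq (𝕜 := ℝ)) X
  rw [(H.hasFDerivAt_inner_linear hq e f).fderiv, (H.hasFDerivAt_inner_linear hq f e).fderiv] at h1
  simpa [real_inner_comm] using h1

theorem inner_velocity_fderiv_linear (H : NormalForm E a B) (hint : CurvatureIsFirstIntegral E)
    {q : Jet 1} (hq : q 1 ≠ 0) (ha : a q ≠ 0) (v h : Plane) :
    ⟪q 1, fderiv ℝ B q (Pi.single 1 h) v⟫_ℝ = -⟪h, B q v⟫_ℝ := by
  have hev : (fun q : Jet 1 => ⟪q 1, B q v⟫_ℝ) =ᶠ[nhds q] fun _ => 0 := by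
    filter_upwards [H.eventually_leading_ne_zero hq ha] with q' hq'
    exact H.inner_velocity_linear hint hq'.1 hq'.2 v
  have h1 := DFunLike.congr_fun (hev.fderiv_eq (𝕜 := ℝ)) (Pi.single 1 h)
  have h2 := (ContinuousLinearMap.apply ℝ Plane v).hasFDerivAt.comp q
    (H.differentiableAt_linear hq).hasFDerivAt
  have h3 := ((ContinuousLinearMap.proj (R := ℝ) (φ := fun _ : Fin 2 => Plane)
      1).hasFDerivAt (x := q)).inner ℝ h2
  have h4 : HasFDerivAt (fun q : Jet 1 => ⟪q 1, B q v⟫_ℝ) _ q := h3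
  rw [h4.fderiv] at h1
  simp at h1
  linarith

theorem fderiv_linear_position (H : NormalForm E a B) (hE : ContDiffOn ℝ ∞ E {z | z 1 ≠ 0})
    (hvar : IsVariational E) (hint : CurvatureIsFirstIntegral E) (hsymm : HasEuclideanSymmetry E)
    {q : Jet 1} (hq : q 1 ≠ 0) (ha : a q ≠ 0) (χ v : Plane) :
    fderiv ℝ B q (Pi.single 0 χ) v = 0 := by
  have h1 := H.snd_fderiv_leading hint hq ha χ v
  have h2 := H.translation_symmetry hsymm hq ha χ v
  rw [H.fderiv_leading_position hE hvar hint hsymm hq ha] at h1 h2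
  rw [mul_zero, zero_mul] at h1
  rw [(mul_eq_zero.1 h1).resolve_right (pow_ne_zero 2 (norm_ne_zero_iff.2 hq)), zero_smul,
    zero_smul, zero_add] at h2
  exact (smul_eq_zero.1 h2).resolve_left ha

/-- The trace of the linear coefficient. -/
noncomputable def linearTrace (B : Jet 1 → Plane →L[ℝ] Plane) (q : Jet 1) : ℝ :=
  ⟪B q !₂[1, 0], !₂[1, 0]⟫_ℝ + ⟪B q !₂[0, 1], !₂[0, 1]⟫_ℝ

theorem fderiv_linearTrace (H : NormalForm E a B) {q : Jet 1} (hq : q 1 ≠ 0) (X : Jet 1) :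
    DifferentiableAt ℝ (linearTrace B) q ∧ fderiv ℝ (linearTrace B) q X =
      ⟪fderiv ℝ B q X !₂[1, 0], !₂[1, 0]⟫_ℝ + ⟪fderiv ℝ B q X !₂[0, 1], !₂[0, 1]⟫_ℝ := by
  have h : HasFDerivAt (linearTrace B) _ q :=
    (H.hasFDerivAt_inner_linear hq !₂[1, 0] !₂[1, 0]).fun_add
    (H.hasFDerivAt_inner_linear hq !₂[0, 1] !₂[0, 1])
  refine ⟨h.differentiableAt, ?_⟩
  rw [h.fderiv]
  simp [real_inner_comm]

theorem fderiv_linearTrace_normal (H : NormalForm E a B) (hint : CurvatureIsFirstIntegral E)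
    (hsymm : HasEuclideanSymmetry E) {q : Jet 1} (hq : q 1 ≠ 0) (ha : a q ≠ 0) :
    fderiv ℝ (linearTrace B) q (Pi.single 1 (eps (q 1))) = 0 := by
  rw [(H.fderiv_linearTrace hq _).2]
  have r0 := H.rotation_symmetry hint hsymm hq ha !₂[1, 0]
  have r1 := H.rotation_symmetry hint hsymm hq ha !₂[0, 1]
  have s0 : eps !₂[(1 : ℝ), 0] = -!₂[(0 : ℝ), 1] := by ext i; fin_cases i <;> simp
  have s1 : eps !₂[(0 : ℝ), 1] = !₂[(1 : ℝ), 0] := by ext i; fin_cases i <;> simp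
  rw [s0, map_neg] at r0
  rw [s1] at r1
  have r00 := congrArg (fun x : Plane => x 0) r0
  have r11 := congrArg (fun x : Plane => x 1) r1
  simp [inner_plane] at r00 r11 ⊢
  linarith

theorem fderiv_linearTrace_tangent (H : NormalForm E a B) (hE : ContDiffOn ℝ ∞ E {z | z 1 ≠ 0})
    (hvar : IsVariational E) (hint : CurvatureIsFirstIntegral E) (hsymm : HasEuclideanSymmetry E)
    {q : Jet 1} (hq : q 1 ≠ 0) (ha : a q ≠ 0) :
    fderiv ℝ (linearTrace B) q (Pi.single 1 (q 1)) = -linearTrace B q := by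
  rw [(H.fderiv_linearTrace hq _).2, linearTrace]
  set e₀ : Plane := !₂[1, 0] with he₀
  set e₁ : Plane := !₂[0, 1] with he₁
  have hcurl : ∀ v e, ⟪fderiv ℝ B q (Pi.single 1 e) v, e⟫_ℝ =
      ⟪fderiv ℝ B q (Pi.single 1 v) e, e⟫_ℝ := by
    intro v e
    have h1 := H.inner_fderiv_linear hE hvar hq v e
    have h2 := H.snd_fderiv_leading hint hq ha (q 1) e
    rw [H.fderiv_leading_position hE hvar hint hsymm hq ha, mul_zero, zero_mul] at h2
    rw [(mul_eq_zero.1 h2).resolve_right (pow_ne_zero 2 (norm_ne_zero_iff.2 hq)),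
      H.fderiv_linear_position hE hvar hint hsymm hq ha] at h1
    simpa using h1
  have hu : ∀ v, fderiv ℝ B q (Pi.single 1 (q 1)) v =
      q 1 0 • fderiv ℝ B q (Pi.single 1 e₀) v + q 1 1 • fderiv ℝ B q (Pi.single 1 e₁) v := by
    intro v
    conv_lhs => rw [plane_eq_sum (q 1)]
    rw [Pi.single_add, Pi.single_smul, Pi.single_smul, map_add, map_smul, map_smul]
    rfl
  have c0 := hcurl e₁ e₀
  have c1 := hcurl e₀ e₁
  have d0 := H.inner_fderiv_linear_comm hE hvar hint hsymm hq ha (Pi.single 1 e₀) e₀ e₁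
  have d1 := H.inner_fderiv_linear_comm hE hvar hint hsymm hq ha (Pi.single 1 e₁) e₀ e₁
  have f0 := H.inner_velocity_fderiv_linear hint hq ha e₀ e₀
  have f1 := H.inner_velocity_fderiv_linear hint hq ha e₁ e₁
  rw [hu, hu]
  have e00 : e₀ 0 = 1 := rfl
  have e01 : e₀ 1 = 0 := rfl
  have e10 : e₁ 0 = 0 := rfl
  have e11 : e₁ 1 = 1 := rfl
  simp only [inner_plane, PiLp.add_apply, PiLp.smul_apply, smul_eq_mul, e00, e01, e10, e11]
    at c0 c1 d0 d1 f0 f1 ⊢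
  linear_combination f0 + f1 - q 1 1 * (c0 + d0) + q 1 0 * (d1 - c1)

theorem exists_linear_eq (H : NormalForm E a B) (hE : ContDiffOn ℝ ∞ E {z | z 1 ≠ 0})
    (hvar : IsVariational E) (hint : CurvatureIsFirstIntegral E) (hsymm : HasEuclideanSymmetry E)
    (ha : ∀ q : Jet 1, q 1 ≠ 0 → a q ≠ 0) :
    ∃ M : ℝ, ∀ q : Jet 1, q 1 ≠ 0 → linearTrace B q * ‖q 1‖ = M := by
  have hder : ∀ q : Jet 1, q 1 ≠ 0 →
      HasFDerivAt (fun q : Jet 1 => linearTrace B q ^ 2 * ‖q 1‖ ^ 2) (0 : Jet 1 →L[ℝ] ℝ) q := by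
    intro q hq
    have h1 := (H.fderiv_linearTrace hq 0).1.hasFDerivAt.pow 2
    have h2 := (((ContinuousLinearMap.proj (R := ℝ) (φ := fun _ : Fin 2 => Plane)
      1).hasFDerivAt (x := q)).norm_sq)
    refine (h1.mul h2).congr_fderiv ?_
    ext1 X
    have hp : ∀ χ : Plane, fderiv ℝ (linearTrace B) q (Pi.single 0 χ) = 0 := by
      intro χ
      rw [(H.fderiv_linearTrace hq _).2, H.fderiv_linear_position hE hvar hint hsymm hq (ha q hq),
        H.fderiv_linear_position hE hvar hint hsymm hq (ha q hq)]
      simp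
    have hv : ‖q 1‖ ^ 2 * fderiv ℝ (linearTrace B) q (Pi.single 1 (X 1)) =
        -linearTrace B q * ⟪q 1, X 1⟫_ℝ := by
      have h := congrArg (fun x : Plane => fderiv ℝ (linearTrace B) q (Pi.single 1 x))
        (norm_sq_smul_eq (q 1) (X 1))
      simp only [Pi.single_add, Pi.single_smul, map_add, map_smul,
        H.fderiv_linearTrace_normal hint hsymm hq (ha q hq),
        H.fderiv_linearTrace_tangent hE hvar hint hsymm hq (ha q hq), smul_eq_mul] at h
      rw [h]; ring
    have h4 : fderiv ℝ (linearTrace B) q X = fderiv ℝ (linearTrace B) q (Pi.single 1 (X 1)) := by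
      conv_lhs => rw [jet_one_eq X, map_add]
      rw [hp, zero_add]
    simp [h4]
    linear_combination 2 * linearTrace B q * hv
  refine exists_eq_const_of_sq (F := fun q => linearTrace B q * ‖q 1‖)
    (G := fun q => linearTrace B q ^ 2 * ‖q 1‖ ^ 2) (fun q hq => ?_) (fun q _ => by ring)
    (fun q hq => (hder q hq).differentiableAt.differentiableWithinAt) (fun q hq => (hder q hq).fderiv)
  exact ((H.fderiv_linearTrace hq 0).1.continuousAt.mul (continuous_apply 1).norm.continuousAt).continuousWithinAt

theorem linear_eq (H : NormalForm E a B) (hE : ContDiffOn ℝ ∞ E {z | z 1 ≠ 0})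
    (hvar : IsVariational E) (hint : CurvatureIsFirstIntegral E) (hsymm : HasEuclideanSymmetry E)
    {q : Jet 1} (hq : q 1 ≠ 0) (ha : a q ≠ 0) (v : Plane) :
    ‖q 1‖ ^ 2 • B q v = linearTrace B q • (‖q 1‖ ^ 2 • v - ⟪v, q 1⟫_ℝ • q 1) := by
  have h0 := H.inner_velocity_linear hint hq ha !₂[1, 0]
  have h1 := H.inner_velocity_linear hint hq ha !₂[0, 1]
  have hs := H.inner_linear_comm hE hvar hint hsymm hq ha !₂[1, 0] !₂[0, 1]
  have hv : B q v = v 0 • B q !₂[1, 0] + v 1 • B q !₂[0, 1] := by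
    conv_lhs => rw [plane_eq_sum v]
    rw [map_add, map_smul, map_smul]
  rw [hv, norm_sq_plane, linearTrace]
  simp only [inner_plane] at *
  simp at h0 h1 hs ⊢
  rw [hs] at h0
  ext i
  fin_cases i
  · simp
    linear_combination v 0 * (q 1 0 * h0 - q 1 1 * h1) + v 1 * (q 1 1 * h0 + q 1 0 * h1)
  · simp [hs]
    linear_combination v 0 * (q 1 1 * h0 + q 1 0 * h1) + v 1 * (q 1 1 * h1 - q 1 0 * h0)

end NormalForm

/-- The linear dependence on the third derivative pins the system down to the circle expression. -/
theorem exists_eq_circleExpression {E : Jet 3 → Plane}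
    (hE : ContDiffOn ℝ ∞ E {z | z 1 ≠ 0}) (hthird : IsThirdOrder E)
    (hvar : IsVariational E) (hsymm : HasEuclideanSymmetry E) (hint : CurvatureIsFirstIntegral E)
    (hline : IncludesStraightLines E) :
    ∃ α m : ℝ, α ≠ 0 ∧ ∀ z : Jet 3, z 1 ≠ 0 → E z = α • circleExpression m z := by
  obtain ⟨a, B, ha, hB, hEq⟩ := exists_normal_form hE hvar hline
  have H : NormalForm E a B := ⟨ha, hB, hEq⟩
  obtain ⟨α, hα, haα⟩ := H.exists_leading_eq hE hvar hint hsymm hthird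
  have ha0 : ∀ q : Jet 1, q 1 ≠ 0 → a q ≠ 0 := by
    intro q hq h
    apply hα
    rw [← haα q hq, h, zero_mul]
  obtain ⟨M, hM⟩ := H.exists_linear_eq hE hvar hint hsymm ha0
  refine ⟨α, M / α, hα, fun z hz => ?_⟩
  have hq : Jet.velocity z 1 ≠ 0 := hz
  have h1 : Jet.velocity z 1 = z 1 := rfl
  have hn : ‖z 1‖ ≠ 0 := norm_ne_zero_iff.2 hz
  have e1 : a (Jet.velocity z) = α / ‖z 1‖ ^ 3 := by
    rw [eq_div_iff (pow_ne_zero 3 hn)]; exact haα _ hq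
  have e2 : fderiv ℝ a (Jet.velocity z) (Pi.single 1 (z 2)) =
      -(3 * α * ⟪z 2, z 1⟫_ℝ / ‖z 1‖ ^ 5) := by
    have h := H.fderiv_leading_velocity hint hq (ha0 _ hq) (z 2)
    rw [e1, h1, real_inner_comm] at h
    field_simp at h ⊢
    linarith
  have e3 : NormalForm.linearTrace B (Jet.velocity z) = M / ‖z 1‖ := by
    rw [eq_div_iff hn]; exact hM _ hq
  have e4 : B (Jet.velocity z) (z 2) =
      (M / ‖z 1‖ ^ 3) • (‖z 1‖ ^ 2 • z 2 - ⟪z 2, z 1⟫_ℝ • z 1) := by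
    have h := H.linear_eq hE hvar hint hsymm hq (ha0 _ hq) (z 2)
    rw [e3, h1] at h
    have h' := congrArg (fun x => (‖z 1‖ ^ 2)⁻¹ • x) h
    simp only [smul_smul, inv_mul_cancel₀ (pow_ne_zero 2 hn), one_smul] at h'
    rw [h']
    congr 1
    field_simp
  rw [H.eq z hz, e1, e2, e4, circleExpression]
  simp only [smul_add, smul_sub, smul_smul]
  congr 1
  · rw [neg_smul, ← sub_eq_add_neg]
    congr 2 <;> ring
  · congr 2 <;> field_simp

theorem HasDerivAt.norm_plane {u : ℝ → Plane} {u' : Plane} {t : ℝ} (h : HasDerivAt u u' t)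
    (hu : u t ≠ 0) : HasDerivAt (fun t => ‖u t‖) (⟪u t, u'⟫_ℝ / ‖u t‖) t := by
  have h1 := h.norm_sq.sqrt (pow_ne_zero 2 (norm_ne_zero_iff.2 hu))
  simp only [Real.sqrt_sq (norm_nonneg _)] at h1
  refine h1.congr_deriv ?_
  have := norm_ne_zero_iff.2 hu
  field_simp

theorem HasDerivAt.inv_norm_plane {u : ℝ → Plane} {u' : Plane} {t : ℝ} (h : HasDerivAt u u' t)
    (hu : u t ≠ 0) : HasDerivAt (fun t => ‖u t‖⁻¹) (-⟪u t, u'⟫_ℝ * ‖u t‖⁻¹ ^ 3) t := by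
  refine ((h.norm_plane hu).fun_inv (norm_ne_zero_iff.2 hu)).congr_deriv ?_
  have := norm_ne_zero_iff.2 hu
  field_simp

theorem HasDerivAt.eps {u : ℝ → Plane} {u' : Plane} {t : ℝ} (h : HasDerivAt u u' t) :
    HasDerivAt (fun t => eps (u t)) (eps u') t :=
  epsL.hasFDerivAt.comp_hasDerivAt t h

theorem contDiffOn_curvatureLagrangian (α m : ℝ) :
    ContDiffOn ℝ ∞ (fun y : Jet 2 => α * curvatureLagrangian m y) {y | y 1 ≠ 0} := by
  have hn : ContDiffOn ℝ ∞ (fun y : Jet 2 => ‖y 1‖) {y | y 1 ≠ 0} :=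
    ContDiffOn.norm ℝ (by fun_prop) fun y hy => hy
  have hc : ContDiffOn ℝ ∞ (fun y : Jet 2 => cross (y 1) (y 2)) {y | y 1 ≠ 0} := by
    unfold cross; fun_prop
  have h := contDiffOn_const (c := α) |>.mul ((hc.div (hn.pow 3) fun y hy =>
    pow_ne_zero 3 (norm_ne_zero_iff.2 hy)).sub (contDiffOn_const (c := m) |>.mul hn))
  exact h

theorem fderiv_curvatureLagrangian (α m : ℝ) {y : Jet 2} (hy : y 1 ≠ 0) (X : Jet 2) :
    fderiv ℝ (fun y : Jet 2 => α * curvatureLagrangian m y) y X =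
      ⟪α • (‖y 1‖⁻¹ ^ 3 • eps (y 2) -
        (3 * ⟪y 1, eps (y 2)⟫_ℝ * ‖y 1‖⁻¹ ^ 5 + m * ‖y 1‖⁻¹) • y 1), X 1⟫_ℝ +
      ⟪-(α * ‖y 1‖⁻¹ ^ 3) • eps (y 1), X 2⟫_ℝ := by
  have hd : DifferentiableAt ℝ (fun y : Jet 2 => α * curvatureLagrangian m y) y :=
    ((contDiffOn_curvatureLagrangian α m).differentiableOn (by simp)).differentiableAt
      ((isOpen_regular 2).mem_nhds hy)
  have hline : HasDerivAt (fun t : ℝ => y + t • X) X 0 := by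
    simpa using ((hasDerivAt_id (0 : ℝ)).smul_const X).const_add y
  have h0 : y + (0 : ℝ) • X = y := by simp
  have h1 := HasFDerivAt.comp_hasDerivAt (f := fun t : ℝ => y + t • X) (0 : ℝ)
    (by rw [h0]; exact hd.hasFDerivAt) hline
  have hs : ∀ s, HasDerivAt (fun t : ℝ => (y + t • X) s) (X s) 0 := hasDerivAt_pi.1 hline
  have hy' : (y + (0 : ℝ) • X) 1 ≠ 0 := by rwa [h0]
  have h2 := ((((hs 1).inner ℝ (hs 2).eps).mul (((hs 1).inv_norm_plane hy').pow 3)).sub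
    (((hs 1).norm_plane hy').const_mul m)).const_mul α
  have h3 := h2.congr_of_eventuallyEq
    (f₁ := (fun y : Jet 2 => α * curvatureLagrangian m y) ∘ fun t : ℝ => y + t • X)
    (Filter.Eventually.of_forall fun t => by
      simp [curvatureLagrangian, cross_eq_inner, div_eq_mul_inv])
  rw [h1.unique h3]
  simp only [zero_smul, add_zero, inner_smul_left, inner_sub_left, inner_neg_left,
    inner_eps_left, conj_trivial, Pi.pow_apply, neg_smul, Nat.add_one_sub_one]
  have hsymm : ⟪eps (y 2), X 1⟫_ℝ = ⟪X 1, eps (y 2)⟫_ℝ := real_inner_comm _ _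
  rw [inner_eps_left] at hsymm
  rw [← hsymm]
  field_simp
  ring

theorem contDiffOn_functionForm {q : ℕ} {L : Jet q → ℝ} {U : Set (Jet q)}
    (hL : ContDiffOn ℝ ∞ L U) : ContDiffOn ℝ ∞ (functionForm L) U :=
  (ContinuousAlternatingMap.constOfIsEmptyLIE ℝ (Jet q) ℝ (Fin 0)).contDiff.comp_contDiffOn hL

/-- The Lagrange derivative of a second-order Lagrange function that does not depend on the
position, expressed by its momenta along a curve. -/
theorem lagrangeDeriv_functionForm_apply {L : Jet 2 → ℝ} (hL : ContDiffOn ℝ ∞ L {y | y 1 ≠ 0})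
    {j v : ℝ → ℕ → Plane} (hj : Holonomic j) (hv : Holonomic v) (h0 : j 0 1 ≠ 0)
    {l₁ l₂ l₁' l₂' l₂'' : ℝ → Plane}
    (hl : ∀ t, j t 1 ≠ 0 → ∀ X, fderiv ℝ L (Jet.trunc 2 (j t)) X = ⟪l₁ t, X 1⟫_ℝ + ⟪l₂ t, X 2⟫_ℝ)
    (hl₁ : ∀ t, j t 1 ≠ 0 → HasDerivAt l₁ (l₁' t) t)
    (hl₂ : ∀ t, j t 1 ≠ 0 → HasDerivAt l₂ (l₂' t) t)
    (hl₂' : ∀ t, j t 1 ≠ 0 → HasDerivAt l₂' (l₂'' t) t) :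
    JetForm.lagrangeDeriv (functionForm L) (Jet.trunc 4 (j 0)) (fun _ => Jet.trunc 4 (v 0)) =
      ⟪l₂'' 0 - l₁' 0, v 0 0⟫_ℝ := by
  have hne := (hj 1 0).continuousAt.eventually_ne h0
  have h := JetForm.lagrangeDeriv_apply_trunc (by norm_num) (contDiffOn_functionForm hL) hj
    (v := fun _ : Fin 1 => v) (fun _ => hv) h0
  refine h.trans ?_
  have hF : ∀ (r : ℕ) (t : ℝ), j t 1 ≠ 0 → JetForm.vertDeriv r
      (fun y => extDeriv (functionForm L) y) (Jet.trunc 2 (j t)) (fun _ => Jet.trunc 2 (v t)) =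
      ⟪l₁ t, (Nat.descFactorial 1 r : ℝ) • v t (1 - r)⟫_ℝ +
        ⟪l₂ t, (Nat.descFactorial 2 r : ℝ) • v t (2 - r)⟫_ℝ := by
    intro r t ht
    have h1 : extDeriv (functionForm L) (Jet.trunc 2 (j t)) =
        ContinuousAlternatingMap.ofSubsingleton ℝ (Jet 2) ℝ (0 : Fin 1)
          (fderiv ℝ L (Jet.trunc 2 (j t))) :=
      extDeriv_constOfIsEmpty L _
    rw [JetForm.vertDeriv, ContinuousAlternatingMap.fderivCompContinuousLinearMap_apply, h1]
    refine (Fin.sum_univ_one _).trans ?_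
    refine Eq.trans ?_ (hl t ht (Jet.vertical 2 r (Jet.trunc 2 (v t))))
    rfl
  have hv1 : ∀ s t, HasDerivAt (fun t => v t s) (v t (s + 1)) t := hv
  have d1 : deriv (fun t => JetForm.vertDeriv 1 (fun y => extDeriv (functionForm L) y)
      (Jet.trunc 2 (j t)) (fun _ => Jet.trunc 2 (v t))) 0 =
      ⟪l₁' 0, v 0 0⟫_ℝ + ⟪l₁ 0, v 0 1⟫_ℝ + 2 * (⟪l₂' 0, v 0 1⟫_ℝ + ⟪l₂ 0, v 0 2⟫_ℝ) := by
    have hev : (fun t => JetForm.vertDeriv 1 (fun y => extDeriv (functionForm L) y)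
        (Jet.trunc 2 (j t)) (fun _ => Jet.trunc 2 (v t))) =ᶠ[nhds 0] fun t =>
        ⟪l₁ t, v t 0⟫_ℝ + 2 * ⟪l₂ t, v t 1⟫_ℝ := by
      filter_upwards [hne] with t ht
      rw [hF 1 t ht]
      simp [inner_smul_right]
    rw [hev.deriv_eq, (((hl₁ 0 h0).inner ℝ (hv1 0 0)).fun_add
      (((hl₂ 0 h0).inner ℝ (hv1 1 0)).const_mul 2)).deriv]
    ring
  have d2 : deriv (deriv fun t => JetForm.vertDeriv 2 (fun y => extDeriv (functionForm L) y)
      (Jet.trunc 2 (j t)) (fun _ => Jet.trunc 2 (v t))) 0 =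
      2 * (⟪l₂'' 0, v 0 0⟫_ℝ + 2 * ⟪l₂' 0, v 0 1⟫_ℝ + ⟪l₂ 0, v 0 2⟫_ℝ) := by
    have hev : (deriv fun t => JetForm.vertDeriv 2 (fun y => extDeriv (functionForm L) y)
        (Jet.trunc 2 (j t)) (fun _ => Jet.trunc 2 (v t))) =ᶠ[nhds 0] fun t =>
        2 * (⟪l₂ t, v t 1⟫_ℝ + ⟪l₂' t, v t 0⟫_ℝ) := by
      filter_upwards [hne.eventually_nhds] with t ht
      have hev' : (fun t => JetForm.vertDeriv 2 (fun y => extDeriv (functionForm L) y)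
          (Jet.trunc 2 (j t)) (fun _ => Jet.trunc 2 (v t))) =ᶠ[nhds t] fun t =>
          2 * ⟪l₂ t, v t 0⟫_ℝ := by
        filter_upwards [ht] with t ht
        rw [hF 2 t ht]
        simp [inner_smul_right, Nat.descFactorial]
      rw [hev'.deriv_eq]
      exact (((hl₂ t ht.self_of_nhds).inner ℝ (hv1 0 t)).const_mul 2).deriv
    rw [hev.deriv_eq, ((((hl₂ 0 h0).inner ℝ (hv1 1 0)).fun_add
      ((hl₂' 0 h0).inner ℝ (hv1 0 0))).const_mul 2).deriv]
    ring
  rw [Fin.sum_univ_three]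
  simp only [Fin.val_zero, Fin.val_one, Fin.val_two, iteratedDeriv_succ, iteratedDeriv_zero]
  rw [d1, d2, hF 0 0 h0]
  simp [inner_sub_left]
  ring

theorem lagrangeDeriv_curvatureLagrangian (α m : ℝ) {z : Jet (2 + 2)} (hz : z 1 ≠ 0) :
    JetForm.lagrangeDeriv (functionForm fun y => α * curvatureLagrangian m y) z =
      JetForm.pullback (Nat.le_succ 3) (sourceForm fun y => α • circleExpression m y) z := by
  ext V
  obtain ⟨j, hj, hjz, -⟩ := exists_holonomic_of_jet z
  obtain ⟨v, hv, hvV, -⟩ := exists_holonomic_of_jet (V 0)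
  have htz : Jet.trunc 4 (j 0) = z := funext hjz
  have htV : V = fun _ => Jet.trunc 4 (v 0) := by
    funext i
    rw [show i = 0 from Fin.ext (by omega)]
    exact (funext hvV : Jet.trunc 4 (v 0) = V 0).symm
  have h0 : j 0 1 ≠ 0 := by rw [← htz] at hz; exact hz
  set ρ : ℝ → ℝ := fun t => ‖j t 1‖⁻¹ with hρ
  have hρ' : ∀ t, j t 1 ≠ 0 → HasDerivAt ρ (-⟪j t 1, j t 2⟫_ℝ * ρ t ^ 3) t := fun t ht =>
    (hj 1 t).inv_norm_plane ht
  have hl₂ : ∀ t, j t 1 ≠ 0 → HasDerivAt (fun t => -(α * ρ t ^ 3) • eps (j t 1))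
      ((3 * α * ρ t ^ 5 * ⟪j t 1, j t 2⟫_ℝ) • eps (j t 1) - (α * ρ t ^ 3) • eps (j t 2)) t := by
    intro t ht
    refine ((((hρ' t ht).fun_pow 3).const_mul α).fun_neg.smul (hj 1 t).eps).congr_deriv ?_
    push_cast
    module
  have hs : ∀ t, HasDerivAt (fun t => ⟪j t 1, j t 2⟫_ℝ) (⟪j t 1, j t 3⟫_ℝ + ⟪j t 2, j t 2⟫_ℝ) t :=
    fun t => (hj 1 t).inner ℝ (hj 2 t)
  have hc : ∀ t, HasDerivAt (fun t => ⟪j t 1, eps (j t 2)⟫_ℝ)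
      (⟪j t 1, eps (j t 3)⟫_ℝ + ⟪j t 2, eps (j t 2)⟫_ℝ) t :=
    fun t => (hj 1 t).inner ℝ (hj 2 t).eps
  have hl₂' := fun t ht => ((((((hρ' t ht).fun_pow 5).const_mul (3 * α)).fun_mul (hs t)).smul
    (hj 1 t).eps)).fun_sub ((((hρ' t ht).fun_pow 3).const_mul α).smul (hj 2 t).eps)
  have hl₁ := fun t ht => ((((hρ' t ht).fun_pow 3).smul (hj 2 t).eps).fun_sub
    (((((hc t).const_mul 3).fun_mul ((hρ' t ht).fun_pow 5)).fun_add
      ((hρ' t ht).const_mul m)).smul (hj 1 t))).fun_const_smul α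
  have h := lagrangeDeriv_functionForm_apply (contDiffOn_curvatureLagrangian α m) hj hv h0
    (fun t ht X => fderiv_curvatureLagrangian α m (y := Jet.trunc 2 (j t)) ht X) hl₁ hl₂ hl₂'
  rw [htV, ← htz]
  refine h.trans ?_
  show _ = ⟪α • circleExpression m (Jet.trunc 3 (j 0)), v 0 0⟫_ℝ
  congr 1
  have hK : ρ 0 ^ 2 * (j 0 1 0 ^ 2 + j 0 1 1 ^ 2) - 1 = 0 := by
    rw [← norm_sq_plane, hρ]
    have := norm_ne_zero_iff.2 h0
    field_simp
    ring
  have hcirc : circleExpression m (Jet.trunc 3 (j 0)) = ρ 0 ^ 3 • eps (j 0 3) -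
      (3 * ⟪j 0 2, j 0 1⟫_ℝ * ρ 0 ^ 5) • eps (j 0 2) +
      (m * ρ 0 ^ 3) • ((j 0 1 0 ^ 2 + j 0 1 1 ^ 2) • j 0 2 - ⟪j 0 2, j 0 1⟫_ℝ • j 0 1) := by
    rw [← norm_sq_plane, circleExpression, hρ]
    simp only [inv_pow, div_eq_mul_inv, one_mul]
    rfl
  rw [hcirc]
  simp only [inner_plane]
  generalize ρ 0 = r at *
  ext i
  fin_cases i
  · simp [eps_apply_zero, eps_apply_one]
    linear_combination (α * (-15 * (j 0 1 0 * j 0 2 0 + j 0 1 1 * j 0 2 1) * r ^ 5 * j 0 2 1 +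
      3 * r ^ 3 * j 0 3 1 - m * r * j 0 2 0)) * hK
  · simp [eps_apply_zero, eps_apply_one]
    linear_combination (α * (15 * (j 0 1 0 * j 0 2 0 + j 0 1 1 * j 0 2 1) * r ^ 5 * j 0 2 0 -
      3 * r ^ 3 * j 0 3 0 - m * r * j 0 2 1)) * hK

theorem theorem1 (E : Jet 3 → Plane)
    (hsmooth : ContDiffOn ℝ ∞ E {z | z 1 ≠ 0})
    (hthird : IsThirdOrder E)
    (hvar : IsVariational E)
    (hsymm : HasEuclideanSymmetry E)
    (hint : CurvatureIsFirstIntegral E)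
    (hcirc : IncludesConstantCurvatureCurves E)
    (hline : IncludesStraightLines E) :
    ∃ α m : ℝ, α ≠ 0 ∧
      (∀ z : Jet 3, z 1 ≠ 0 → E z = α • circleExpression m z) ∧
      (∀ z : Jet (2 + 2), z 1 ≠ 0 →
        JetForm.lagrangeDeriv (functionForm fun y => α * curvatureLagrangian m y) z =
          JetForm.pullback (Nat.le_succ 3) (sourceForm E) z) := by
  obtain ⟨α, m, hα, hE⟩ := exists_eq_circleExpression hsmooth hthird hvar hsymm hint hline
  refine ⟨α, m, hα, hE, fun z hz => ?_⟩
  rw [lagrangeDeriv_curvatureLagrangian α m hz]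
  simp only [JetForm.pullback, sourceForm]
  rw [hE (Jet.proj (Nat.le_succ 3) z) hz]
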